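/- **Theorem 5.3.** Let $k$ be a field, let $n\ge 0$, let $E=k\langle x_1,\dots,x_n\rangle/\langle x_i^2,\;x_ix_j+x_jx_i\rangle$ be the exterior algebra and let $S=k[x_1,\dots,x_n]$ be the commutative polynomial ring, both multigraded by $\mathbb N^n$ with $\deg x_j$ the $j$-th unit vector. Let $E\otimes_k E^{\rm op}$ carry the ordinary (unsigned) product, let it act on $E$ by $(a\otimes b)\cdot m=a\,m\,b$, and let $k$ be the trivial bimodule, on which all $x_j$ act as $0$. (1) For $i\ge 0$ let $$F_i=\bigoplus_{\substack{1\le i_1<\dots<i_r\le n\\ l_1,\dots,l_r\ge 1,\; l_1+\dots+l_r=i}} (E\otimes E^{\rm op})\;e_{i_1}^{(l_1)}\cdots e_{i_r}^{(l_r)},$$ where $e_j^{(0)}:=1$, and for $i\ge 1$ let $\partial:F_i\to F_{i-1}$ be the $E\otimes E^{\rm op}$-linear map with $$\partial\big(e_{i_1}^{(l_1)}\cdots e_{i_r}^{(l_r)}\big)=\sum_{j=1}^r \big(x_{i_j}\otimes 1+(-1)^{i}\,1\otimes x_{i_j}\big)\; e_{i_1}^{(l_1)}\cdots e_{i_j}^{(l_j-1)}\cdots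 e_{i_r}^{(l_r)},\qquad i=l_1+\dots+l_r .$$ Then $(F_\bullet,\partial)$, with the augmentation $F_0=E\otimes E^{\rm op}\to E$, $a\otimes b\mapsto ab$, is a minimal free resolution of $E$ as an $E\otimes E^{\rm op}$-module. It is multigraded, with $\deg e_{i_1}^{(l_1)}\cdots e_{i_r}^{(l_r)}=\deg x_{i_1}^{l_1}\cdots x_{i_r}^{l_r}$; minimal means that $\partial(F_{i+1})\subseteq\mathfrak m F_i$, where $\mathfrak m$ is the kernel of the augmentation $E\otimes E^{\rm op}\to k$. (2) For $A=E$ or $A=S$ let $HH(A,k)$ be the Hochschild homology of $A$ with coefficients in $k$, that is, the homology of $k\otimes_{A\otimes A^{\rm op}}HC^A_\bullet$ with $HC^A_i=A^{\otimes(i+2)}$ and $\partial(a_0\otimes\dots\otimes a_{i+1})=\sum_{j=0}^{i}(-1)^j a_0\otimes\dots\otimes a_ja_{j+1}\otimes\dots\otimes a_{i+1}$, and put $\mathrm{Hilb}(HH(A,k))=\sum_{i,\alpha}\dim_k\big(HH_i(A,k)_\alpha\big)x^\alpha t^i$. Then $$\mathrm{Hilb}(HH(E,k))=\sum_{i,\alpha}\dim_k\Big(\mathrm{Tor}_i^{E\otimes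 E^{\rm op}}(k,E)_\alpha\Big)x^\alpha t^i,$$ where the multigraded Tor is computed by any multigraded free resolution of $E$ over $E\otimes E^{\rm op}$. (3) With $\mathrm{Hilb}(A)=\sum_\alpha \dim_k(A_\alpha)\,x^\alpha t^{|\alpha|}$, where $|\alpha|=\alpha_1+\dots+\alpha_n$, there is the duality $$\mathrm{Hilb}(HH(E,k))=\mathrm{Hilb}(S),\qquad \mathrm{Hilb}(HH(S,k))=\mathrm{Hilb}(E).$$ -/

import Mathlib

open scoped TensorProduct

noncomputable section

namespace HochschildDuality

universe u v w

/-! ### Enveloping algebra and bimodules -/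

section Env

variable (k : Type u) [Field k] (A : Type v) [Ring A] [Algebra k A]

/-- The enveloping algebra `A ⊗ Aᵒᵖ`, with the usual product
`(a ⊗ b) (a' ⊗ b') = a a' ⊗ (b * b')`, the second product being taken in `Aᵒᵖ`. -/
abbrev Env : Type v := A ⊗[k] Aᵐᵒᵖ

/-- `A` as a left module over `A ⊗ Aᵒᵖ`: `(a ⊗ b) • m = a m b`. -/
instance envModuleSelf : Module (Env k A) A := TensorProduct.Algebra.module

variable {k A}

theorem env_tmul_smul (a : A) (b : Aᵐᵒᵖ) (m : A) :
    (a ⊗ₜ[k] b : Env k A) • m = a * m * b.unop := by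
  have h : (a ⊗ₜ[k] b : Env k A) • m = a • b • m := TensorProduct.Algebra.smul_def a b m
  rw [h, MulOpposite.smul_eq_mul_unop, smul_eq_mul, mul_assoc]

/-- The augmentation of `A ⊗ Aᵒᵖ` given by an augmentation `ε` of `A`: `a ⊗ b ↦ ε a * ε b`. -/
def envAug (ε : A →ₐ[k] k) : Env k A →ₐ[k] k :=
  Algebra.TensorProduct.lift ε (AlgHom.fromOpposite ε fun _ _ => Commute.all _ _)
    fun _ _ => Commute.all _ _

end Env

/-! ### Multigradings and Hilbert series

Multidegrees are elements `α : σ →₀ ℕ`; a multigrading is recorded by its family of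
homogeneous components. -/

section Grading

variable {k : Type u} [Field k] {σ : Type*}

/-- Component of multidegree `α` of an algebra generated by elements `x s` of multidegree
`e_s`: the span of all words in the `x s` in which each letter `x s` occurs `α s` times. -/
def algPiece {A : Type v} [Ring A] [Algebra k A] (x : σ → A) (α : σ →₀ ℕ) : Submodule k A :=
  Submodule.span k
    {a | ∃ l : List σ, (l.map fun s => Finsupp.single s 1).sum = α ∧ a = (l.map x).prod}

/-- Component of multidegree `α` of `A ⊗ Aᵒᵖ`. -/
def envPiece {A : Type v} [Ring A] [Algebra k A] (x : σ → A) (α : σ →₀ ℕ) :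
    Submodule k (Env k A) :=
  Submodule.span k {r | ∃ β γ : σ →₀ ℕ, β + γ = α ∧
    ∃ a ∈ algPiece (k := k) x β, ∃ b ∈ algPiece (k := k) x γ, r = a ⊗ₜ[k] MulOpposite.op b}

/-- Component of multidegree `α` of the free module over a multigraded algebra `R` on a basis
`B` whose element `b` has multidegree `deg b`. -/
def freePiece {R : Type v} [Ring R] [Algebra k R] (Rgr : (σ →₀ ℕ) → Submodule k R)
    {B : Type w} (deg : B → σ →₀ ℕ) (α : σ →₀ ℕ) : Submodule k (B →₀ R) :=
  Submodule.span k {f | ∃ b, ∃ γ, γ + deg b = α ∧ ∃ r ∈ Rgr γ, f = Finsupp.single b r}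

/-- The `k`-dimension of a vector space, as an element of `ℕ ∪ {∞}`. -/
def dimK (V : Type*) [AddCommGroup V] [Module k V] : ℕ∞ := Cardinal.toENat (Module.rank k V)

/-- Hilbert series `∑ dim (A_α) x^α t^|α|` of an algebra generated by elements `x s` of
multidegree `e_s`. The exponent of `t` is stored at `none`, the one of `x_s` at `some s`. -/
def hilbAlg (k : Type u) [Field k] {A : Type v} [Ring A] [Algebra k A] (x : σ → A) :
    MvPowerSeries (Option σ) ℕ∞ :=
  fun m => if m none = m.some.degree then dimK (k := k) (algPiece (k := k) x m.some) else 0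

end Grading

/-! ### Tensoring with the residue field, and homology with its multigrading -/

section Residue

variable {k : Type u} [Field k] {R : Type v} [Ring R] [Algebra k R] (ε : R →ₐ[k] k)

/-- The relations `c · r ⊗ m = c ⊗ r · m` defining `k ⊗_R M`, where `k` is a right `R`-module
through the augmentation `ε`. -/
def residueRel (M : Type w) [AddCommGroup M] [Module k M] [Module R M] : Submodule k (k ⊗[k] M) :=
  Submodule.span k {z | ∃ (c : k) (r : R) (m : M), z = (c * ε r) ⊗ₜ[k] m - c ⊗ₜ[k] (r • m)}

/-- The tensor product `k ⊗_R M` of the right `R`-module `k` (through `ε`) and the left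
`R`-module `M`. -/
abbrev ResidueTensor (M : Type w) [AddCommGroup M] [Module k M] [Module R M] : Type (max u w) :=
  (k ⊗[k] M) ⧸ residueRel ε M

variable {M N : Type w} [AddCommGroup M] [Module k M] [Module R M] [IsScalarTower k R M]
  [AddCommGroup N] [Module k N] [Module R N] [IsScalarTower k R N]

/-- The map `k ⊗_R f`. -/
def ResidueTensor.map (f : M →ₗ[R] N) : ResidueTensor ε M →ₗ[k] ResidueTensor ε N :=
  Submodule.mapQ _ _ (LinearMap.lTensor k (f.restrictScalars k)) (by
    rw [residueRel, Submodule.span_le]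
    rintro _ ⟨c, r, m, rfl⟩
    refine Submodule.subset_span ⟨c, r, f m, ?_⟩
    simp)

/-- The component of multidegree `α` of `k ⊗_R M`, with `k` in multidegree `0`: the classes
`1 ⊗ m` for `m` in the component of multidegree `α` of `M`. -/
def ResidueTensor.piece (P : Submodule k M) : Submodule k (ResidueTensor ε M) :=
  P.map ((residueRel ε M).mkQ ∘ₗ TensorProduct.mk k k M 1)

end Residue

section Homology

variable {k : Type u} [Field k] {σ : Type*} {X : ℕ → Type w} [∀ i, AddCommGroup (X i)]
  [∀ i, Module k (X i)]

/-- Cycles of `⋯ → X 2 → X 1 → X 0 → 0`. -/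
def cycles (d : ∀ i, X (i + 1) →ₗ[k] X i) : ∀ i, Submodule k (X i)
  | 0 => ⊤
  | i + 1 => LinearMap.ker (d i)

/-- Homology (cycles modulo boundaries) of `⋯ → X 2 → X 1 → X 0 → 0`. -/
abbrev Homology (d : ∀ i, X (i + 1) →ₗ[k] X i) (i : ℕ) : Type w :=
  cycles d i ⧸ (LinearMap.range (d i)).submoduleOf (cycles d i)

/-- The component of multidegree `α` of the homology: classes of cycles of multidegree `α`. -/
def homologyPiece (d : ∀ i, X (i + 1) →ₗ[k] X i) (gr : ∀ i, (σ →₀ ℕ) → Submodule k (X i))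
    (i : ℕ) (α : σ →₀ ℕ) : Submodule k (Homology d i) :=
  ((gr i α).submoduleOf (cycles d i)).map (Submodule.mkQ _)

/-- Hilbert series `∑ dim (H_i)_α x^α t^i` of the homology of a multigraded complex. -/
def hilbHomology (d : ∀ i, X (i + 1) →ₗ[k] X i) (gr : ∀ i, (σ →₀ ℕ) → Submodule k (X i)) :
    MvPowerSeries (Option σ) ℕ∞ :=
  fun m => dimK (k := k) (homologyPiece d gr (m none) m.some)

/-- Hilbert series `∑ dim (H_i(k ⊗_R X))_α x^α t^i` for a complex `X` of left modules over an
augmented algebra `R`, with a multigrading `gr`. -/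
def hilbResidue {R : Type v} [Ring R] [Algebra k R] (ε : R →ₐ[k] k) [∀ i, Module R (X i)]
    [∀ i, IsScalarTower k R (X i)] (d : ∀ i, X (i + 1) →ₗ[R] X i)
    (gr : ∀ i, (σ →₀ ℕ) → Submodule k (X i)) : MvPowerSeries (Option σ) ℕ∞ :=
  hilbHomology (X := fun i => ResidueTensor ε (X i)) (fun i => ResidueTensor.map ε (d i))
    (fun i α => ResidueTensor.piece ε (gr i α))

end Homology

/-! ### Multigraded free resolutions -/

section Resolution

variable {k : Type u} [Field k] {σ : Type*} {R : Type v} [Ring R] [Algebra k R]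
  {N : Type w} [AddCommGroup N] [Module k N] [Module R N]

/-- `⋯ → R^(B 1) → R^(B 0) → N → 0` is a multigraded free resolution of `N`: it is exact, the
basis element `b ∈ B i` is homogeneous of multidegree `deg i b`, and all maps preserve
multidegrees. -/
structure IsMultigradedFreeResolution (Rgr : (σ →₀ ℕ) → Submodule k R)
    (Ngr : (σ →₀ ℕ) → Submodule k N) {B : ℕ → Type*} (deg : ∀ i, B i → σ →₀ ℕ)
    (d : ∀ i, (B (i + 1) →₀ R) →ₗ[R] (B i →₀ R)) (aug : (B 0 →₀ R) →ₗ[R] N) : Prop where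
  aug_surjective : Function.Surjective aug
  exact_zero : Function.Exact (d 0) aug
  exact_succ : ∀ i, Function.Exact (d (i + 1)) (d i)
  aug_homogeneous : ∀ b, aug (Finsupp.single b 1) ∈ Ngr (deg 0 b)
  d_homogeneous : ∀ i b, d i (Finsupp.single b 1) ∈ freePiece Rgr (deg i) (deg (i + 1) b)

/-- Minimality of a complex of free modules over an algebra with augmentation `ε`: the image of
every differential is contained in `(ker ε) F`, i.e. all coefficients lie in `ker ε`. -/
def IsMinimal (ε : R →ₐ[k] k) {B : ℕ → Type*} (d : ∀ i, (B (i + 1) →₀ R) →ₗ[R] (B i →₀ R)) :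
    Prop :=
  ∀ i y b, ε (d i y b) = 0

/-- The series `∑ dim Tor_i^R(k, N)_α x^α t^i` computed from a multigraded free resolution
`⋯ → R^(B 1) → R^(B 0) → N → 0`, i.e. the Hilbert series of the homology of `k ⊗_R R^(B i)`. -/
def hilbTor (ε : R →ₐ[k] k) (Rgr : (σ →₀ ℕ) → Submodule k R) {B : ℕ → Type*}
    (deg : ∀ i, B i → σ →₀ ℕ) (d : ∀ i, (B (i + 1) →₀ R) →ₗ[R] (B i →₀ R)) :
    MvPowerSeries (Option σ) ℕ∞ :=
  hilbResidue (X := fun i => B i →₀ R) ε d fun i => freePiece Rgr (deg i)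

end Resolution

/-! ### The acyclic Hochschild complex -/

section Hochschild

/-- An action of an algebra `C` on `A`, applied to the `j`-th factor of `A ⊗ ⋯ ⊗ A`. -/
def actAt {k : Type u} [Field k] {A : Type v} [AddCommGroup A] [Module k A] {C : Type w} [Ring C]
    [Algebra k C] {m : ℕ} (j : Fin m) (φ : C →ₐ[k] Module.End k A) :
    C →ₐ[k] Module.End k (⨂[k] _ : Fin m, A) :=
  AlgHom.ofLinearMap
    ((PiTensorProduct.mapMultilinear k (fun _ : Fin m => A) (fun _ => A)).toLinearMap
      (fun _ => LinearMap.id) j ∘ₗ φ.toLinearMap)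
    (by
      refine PiTensorProduct.ext (MultilinearMap.ext fun a => ?_)
      simp only [LinearMap.comp_apply, AlgHom.toLinearMap_apply, map_one,
        MultilinearMap.toLinearMap_apply, PiTensorProduct.mapMultilinear_apply,
        LinearMap.compMultilinearMap_apply, PiTensorProduct.map_tprod, Module.End.one_apply]
      congr 1
      funext l
      by_cases h : l = j
      · subst h; simp
      · simp [Function.update_of_ne h])
    (by
      intro x y
      refine PiTensorProduct.ext (MultilinearMap.ext fun a => ?_)
      simp only [LinearMap.comp_apply, AlgHom.toLinearMap_apply, map_mul,
        MultilinearMap.toLinearMap_apply, PiTensorProduct.mapMultilinear_apply,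
        LinearMap.compMultilinearMap_apply, PiTensorProduct.map_tprod, Module.End.mul_apply]
      congr 1
      funext l
      by_cases h : l = j
      · subst h; simp
      · simp [Function.update_of_ne h])

theorem actAt_tprod {k : Type u} [Field k] {A : Type v} [AddCommGroup A] [Module k A] {C : Type w}
    [Ring C] [Algebra k C] {m : ℕ} (j : Fin m) (φ : C →ₐ[k] Module.End k A) (c : C)
    (a : Fin m → A) :
    actAt j φ c (PiTensorProduct.tprod k a)
      = PiTensorProduct.tprod k (Function.update a j (φ c (a j))) := by
  have h : actAt j φ c (PiTensorProduct.tprod k a) = PiTensorProduct.map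
      (Function.update (fun _ => LinearMap.id) j (φ c)) (PiTensorProduct.tprod k a) := rfl
  rw [h, PiTensorProduct.map_tprod]
  congr 1
  funext l
  by_cases h : l = j
  · subst h; simp
  · simp [Function.update_of_ne h]

variable (k : Type u) [Field k] (A : Type v) [Ring A] [Algebra k A]

/-- `A ⊗ Aᵒᵖ` acts on `A^{⊗ (i + 2)}` by left multiplication on the first factor and right
multiplication on the last one. -/
def bimoduleAct (i : ℕ) : Env k A →ₐ[k] Module.End k (⨂[k] _ : Fin (i + 2), A) :=
  Algebra.TensorProduct.lift
    (actAt (0 : Fin (i + 2)) (Algebra.lsmul k k A : A →ₐ[k] Module.End k A))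
    (actAt (Fin.last (i + 1)) (Algebra.lsmul k k A : Aᵐᵒᵖ →ₐ[k] Module.End k A)) (by
      intro x y
      refine PiTensorProduct.ext (MultilinearMap.ext fun a => ?_)
      have h : (0 : Fin (i + 2)) ≠ Fin.last (i + 1) := (Fin.last_pos).ne
      simp only [LinearMap.compMultilinearMap_apply, Module.End.mul_apply, actAt_tprod,
        Function.update_of_ne h, Function.update_of_ne h.symm, Function.update_comm h])

/-- The `i`-th term `A^{⊗ (i + 2)}` of the acyclic Hochschild complex. -/
def HC (i : ℕ) : Type (max u v) := ⨂[k] _ : Fin (i + 2), A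

instance (i : ℕ) : AddCommGroup (HC k A i) :=
  inferInstanceAs (AddCommGroup (⨂[k] _ : Fin (i + 2), A))

instance (i : ℕ) : Module k (HC k A i) :=
  inferInstanceAs (Module k (⨂[k] _ : Fin (i + 2), A))

variable {A}

/-- The pure tensor `a 0 ⊗ ⋯ ⊗ a (i + 1)`. -/
def HC.tprod (i : ℕ) : MultilinearMap k (fun _ : Fin (i + 2) => A) (HC k A i) :=
  PiTensorProduct.tprod k

variable {k}

theorem HC.hom_ext {i : ℕ} {V : Type*} [AddCommGroup V] [Module k V] {f g : HC k A i →ₗ[k] V}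
    (h : ∀ a, f (HC.tprod k i a) = g (HC.tprod k i a)) : f = g :=
  PiTensorProduct.ext (MultilinearMap.ext h)

variable (k A)

/-- The action of `A ⊗ Aᵒᵖ` on `A^{⊗ (i + 2)}`. -/
def HC.act (i : ℕ) : Env k A →ₐ[k] Module.End k (HC k A i) := bimoduleAct k A i

instance (i : ℕ) : Module (Env k A) (HC k A i) :=
  Module.compHom (HC k A i) (HC.act k A i).toRingHom

variable {k A}

theorem HC.smul_def {i : ℕ} (r : Env k A) (m : HC k A i) : r • m = HC.act k A i r m := rfl

instance (i : ℕ) : IsScalarTower k (Env k A) (HC k A i) where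
  smul_assoc c r m := by simp only [HC.smul_def, map_smul, LinearMap.smul_apply]

/-- `(μ ⊗ γ) • (a₀ ⊗ ⋯ ⊗ aₗ) = (μ a₀) ⊗ a₁ ⊗ ⋯ ⊗ (aₗ γ)`. -/
theorem HC.tmul_smul_tprod {i : ℕ} (x : A) (y : Aᵐᵒᵖ) (a : Fin (i + 2) → A) :
    (x ⊗ₜ[k] y : Env k A) • HC.tprod k i a
      = HC.tprod k i fun l =>
        (if l = 0 then x else 1) * a l * (if l = Fin.last (i + 1) then y.unop else 1) := by
  have h : (0 : Fin (i + 2)) ≠ Fin.last (i + 1) := (Fin.last_pos).ne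
  change actAt _ _ x (actAt _ _ y (PiTensorProduct.tprod k a)) = PiTensorProduct.tprod k _
  rw [actAt_tprod, actAt_tprod, Function.update_of_ne h]
  congr 1
  funext l
  by_cases h0 : l = 0
  · subst h0; simp [h]
  · by_cases h1 : l = Fin.last (i + 1)
    · subst h1; simp [h.symm]
    · simp [h0, h1]

/-- Multiplying two neighbouring entries depends linearly on each entry. -/
theorem contractNth_update {m : ℕ} (j : Fin m) (a : Fin (m + 1) → A) (p : Fin (m + 1)) :
    ∃ (q : Fin m) (L : A →ₗ[k] A), ∀ x,
      Fin.contractNth j.castSucc (· * ·) (Function.update a p x)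
        = Function.update (Fin.contractNth j.castSucc (· * ·) a) q (L x) := by
  obtain ⟨p, hp⟩ := p
  obtain ⟨j, hj⟩ := j
  rcases lt_trichotomy p j with h | h | h
  · refine ⟨⟨p, by omega⟩, LinearMap.id, fun x => ?_⟩
    funext ⟨l, hl⟩
    simp only [Fin.contractNth, Function.update_apply, Fin.ext_iff, Fin.val_castSucc, Fin.val_succ,
      LinearMap.id_apply]
    split_ifs <;> first | rfl | omega
  · refine ⟨⟨j, hj⟩, LinearMap.mulRight k (a ⟨j + 1, by omega⟩), fun x => ?_⟩
    funext ⟨l, hl⟩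
    simp only [Fin.contractNth, Function.update_apply, Fin.ext_iff, Fin.val_castSucc, Fin.val_succ,
      LinearMap.mulRight_apply]
    split_ifs <;> first | rfl | omega | (subst_vars; rfl)
  · by_cases h' : p = j + 1
    · refine ⟨⟨j, hj⟩, LinearMap.mulLeft k (a ⟨j, by omega⟩), fun x => ?_⟩
      funext ⟨l, hl⟩
      simp only [Fin.contractNth, Function.update_apply, Fin.ext_iff, Fin.val_castSucc,
        Fin.val_succ, LinearMap.mulLeft_apply]
      split_ifs <;> first | rfl | omega | (subst_vars; rfl)
    · refine ⟨⟨p - 1, by omega⟩, LinearMap.id, fun x => ?_⟩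
      funext ⟨l, hl⟩
      simp only [Fin.contractNth, Function.update_apply, Fin.ext_iff, Fin.val_castSucc,
        Fin.val_succ, LinearMap.id_apply]
      split_ifs <;> first | rfl | omega

/-- The multilinear map `a ↦ a 0 ⊗ ⋯ ⊗ a j * a (j + 1) ⊗ ⋯ ⊗ a (i + 2)`. -/
def HC.face (i : ℕ) (j : Fin (i + 2)) : MultilinearMap k (fun _ : Fin (i + 3) => A) (HC k A i) where
  toFun a := HC.tprod k i (Fin.contractNth j.castSucc (· * ·) a)
  map_update_add' {inst} a p x y := by
    rw [Subsingleton.elim inst (instDecidableEqFin _)]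
    obtain ⟨q, L, h⟩ := contractNth_update (k := k) j a p
    simp only [h, map_add, MultilinearMap.map_update_add]
  map_update_smul' {inst} a p c x := by
    rw [Subsingleton.elim inst (instDecidableEqFin _)]
    obtain ⟨q, L, h⟩ := contractNth_update (k := k) j a p
    simp only [h, map_smul, MultilinearMap.map_update_smul]

/-- The Hochschild differential as a `k`-linear map. -/
def HC.dLin (i : ℕ) : HC k A (i + 1) →ₗ[k] HC k A i :=
  PiTensorProduct.lift (∑ j : Fin (i + 2), (-1 : k) ^ (j : ℕ) • HC.face i j)

theorem HC.dLin_tprod (i : ℕ) (a : Fin (i + 3) → A) :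
    HC.dLin i (HC.tprod k (i + 1) a) = ∑ j : Fin (i + 2), (-1 : k) ^ (j : ℕ) •
      HC.tprod k i (Fin.contractNth j.castSucc (· * ·) a) := by
  have h : HC.dLin i (HC.tprod k (i + 1) a)
      = (∑ j : Fin (i + 2), (-1 : k) ^ (j : ℕ) • HC.face i j) a :=
    PiTensorProduct.lift.tprod a
  rw [h, sum_apply]
  rfl

theorem HC.dLin_smul (i : ℕ) (r : Env k A) (m : HC k A (i + 1)) :
    HC.dLin i (r • m) = r • HC.dLin i m := by
  induction r using TensorProduct.induction_on with
  | zero =>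
    rw [zero_smul (Env k A) m, zero_smul (Env k A) (HC.dLin i m), map_zero]
  | add r s hr hs =>
    rw [add_smul (r : Env k A) s m, add_smul (r : Env k A) s (HC.dLin i m), map_add, hr, hs]
  | tmul x y =>
    suffices h : HC.dLin i ∘ₗ HC.act k A (i + 1) (x ⊗ₜ[k] y)
        = HC.act k A i (x ⊗ₜ[k] y) ∘ₗ HC.dLin i from LinearMap.congr_fun h m
    refine HC.hom_ext fun a => ?_
    simp only [LinearMap.comp_apply, ← HC.smul_def, HC.tmul_smul_tprod, HC.dLin_tprod]
    rw [HC.smul_def, map_sum]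
    refine Finset.sum_congr rfl fun j _ => ?_
    rw [map_smul, ← HC.smul_def, HC.tmul_smul_tprod]
    congr 2
    obtain ⟨j, hj⟩ := j
    funext ⟨l, hl⟩
    simp only [Fin.contractNth, Fin.ext_iff, Fin.val_castSucc, Fin.val_succ, Fin.val_zero,
      Fin.val_last]
    split_ifs <;> first | contradiction | omega | simp [mul_assoc]

variable (k A)

/-- The differential
`a₀ ⊗ ⋯ ⊗ a_{i+2} ↦ ∑_{j=0}^{i+1} (-1)^j a₀ ⊗ ⋯ ⊗ a_j a_{j+1} ⊗ ⋯ ⊗ a_{i+2}`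
of the acyclic Hochschild complex (see `HC.dLin_tprod`). -/
def HC.d (i : ℕ) : HC k A (i + 1) →ₗ[Env k A] HC k A i where
  toFun := HC.dLin i
  map_add' := map_add _
  map_smul' := HC.dLin_smul i

variable {k A}

/-- Component of multidegree `α` of `A^{⊗ (i + 2)}`. -/
def HC.piece {σ : Type*} (x : σ → A) (i : ℕ) (α : σ →₀ ℕ) : Submodule k (HC k A i) :=
  Submodule.span k {z | ∃ β : Fin (i + 2) → σ →₀ ℕ, ∑ l, β l = α ∧
    ∃ a : Fin (i + 2) → A, (∀ l, a l ∈ algPiece (k := k) x (β l)) ∧ z = HC.tprod k i a}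

/-- Hilbert series `∑ dim HH_i(A, k)_α x^α t^i` of the Hochschild homology of `A` with
coefficients in `k`, i.e. of the homology of `k ⊗_{A ⊗ Aᵒᵖ} HC`, for an algebra `A` with
augmentation `ε` and generators `x s` of multidegree `e_s`. -/
def hilbHH {σ : Type*} (ε : A →ₐ[k] k) (x : σ → A) : MvPowerSeries (Option σ) ℕ∞ :=
  hilbResidue (envAug ε) (HC.d k A) (HC.piece x)

end Hochschild

/-! ### The exterior algebra and its divided power complex -/

section Cartan

variable (k : Type u) [Field k] (n : ℕ)

/-- The exterior algebra on `n` generators over `k`. -/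
abbrev ExtAlg : Type u := ExteriorAlgebra k (Fin n → k)

/-- The generator `x_j` of the exterior algebra. -/
def ExtAlg.x (j : Fin n) : ExtAlg k n := ExteriorAlgebra.ι k (Pi.single j 1)

/-- The augmentation of the exterior algebra, `x_j ↦ 0`. -/
def ExtAlg.aug : ExtAlg k n →ₐ[k] k := ExteriorAlgebra.algebraMapInv

/-- The augmentation of the polynomial ring, `X j ↦ 0`. -/
def polyAug : MvPolynomial (Fin n) k →ₐ[k] k := MvPolynomial.aeval 0

/-- The basis in homological degree `i`: the symbols `e_1^{(l_1)} ⋯ e_n^{(l_n)}` with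
`l_1 + ⋯ + l_n = i`, where `e_j^{(0)}` is omitted. -/
abbrev CartanBasis (n i : ℕ) : Type := {l : Fin n →₀ ℕ // l.degree = i}

/-- The symbol with `e_j^{(l_j)}` replaced by `e_j^{(l_j - 1)}`. -/
def CartanBasis.lower {n i : ℕ} (l : CartanBasis n (i + 1)) (j : Fin n) (h : l.1 j ≠ 0) :
    CartanBasis n i :=
  ⟨l.1 - Finsupp.single j 1, by
    have h1 : Finsupp.single j 1 ≤ l.1 := by
      rw [Finsupp.single_le_iff]; omega
    have h2 := congrArg Finsupp.degree (tsub_add_cancel_of_le h1)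
    rw [map_add, Finsupp.degree_single, l.2] at h2
    omega⟩

/-- The differential
`e^{(l)} ↦ ∑_{j, l_j > 0} (x_j ⊗ 1 + (-1)^{i+1} 1 ⊗ x_j) e_1^{(l_1)} ⋯ e_j^{(l_j - 1)} ⋯ e_n^{(l_n)}`
from homological degree `i + 1` to `i`. -/
def cartanD (i : ℕ) :
    (CartanBasis n (i + 1) →₀ Env k (ExtAlg k n)) →ₗ[Env k (ExtAlg k n)]
      (CartanBasis n i →₀ Env k (ExtAlg k n)) :=
  Finsupp.linearCombination (Env k (ExtAlg k n)) fun l => ∑ j : Fin n,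
    if h : l.1 j ≠ 0 then
      Finsupp.single (l.lower j h)
        (ExtAlg.x k n j ⊗ₜ[k] 1 + (-1 : k) ^ (i + 1) • 1 ⊗ₜ[k] MulOpposite.op (ExtAlg.x k n j))
    else 0

/-- The augmentation `F_0 = E ⊗ Eᵒᵖ → E`, `(a ⊗ b) e^{(0)} ↦ a b`. -/
def cartanAug : (CartanBasis n 0 →₀ Env k (ExtAlg k n)) →ₗ[Env k (ExtAlg k n)] ExtAlg k n :=
  Finsupp.linearCombination (Env k (ExtAlg k n)) fun _ => (1 : ExtAlg k n)

end Cartan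

end HochschildDuality

end

open HochschildDuality

open scoped TensorProduct

set_option linter.unusedSectionVars false

noncomputable section

namespace HochschildDuality

universe u v w w' w''

/-! ### Homotopy invariance of the Hilbert series of homology -/

section HomologyInvariance

variable {k : Type*} [Field k] {σ : Type*}

/-! Hochschild homology with coefficients in `k` is a Tor. The bar complex is a multigraded free
resolution of `A` over `A ⊗ Aᵒᵖ`, contracted by `a ↦ 1 ⊗ a` (`HC.isGradedBasisResolution`). Any two
multigraded free resolutions are linked by multigraded chain maps that are mutually inverse up to
homotopy. The homotopies need not be graded, since they only serve to show that the graded maps are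
inverse on homology (`IsGradedBasisResolution.hilbResidue_eq`). This gives `hilbHH_eq_hilbTor` for
every algebra with a homogeneous basis.

Over a minimal resolution the differentials vanish after tensoring with `k`, so Tor just counts
basis symbols by degree (`hilbTor_of_isMinimal`). For `E` the divided power complex is minimal, with
symbols `e^{(l)}` indexed like the monomials of `S`. For `S` the Koszul complex on the `X_j ⊗ 1 - 1
⊗ X_j` is minimal, with symbols `e_I` indexed like the squarefree monomials, a basis of `E`. In both
cases the homological degree of a symbol is its total multidegree. This is the duality.

Exactness of both complexes has one proof. For each variable `m` there is a `k`-linear homotopy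
which undoes multiplication by the `m`-th coefficient (contraction for `E`, divided difference for
`S`) and puts `e_m` into the symbol. Then `d h + h d` preserves every free summand and is the
identity on those whose symbol contains `e_m`. In positive degree every symbol contains some `e_m`,
so correcting a cycle for one variable after the other reduces it to zero
(`exact_of_partial_homotopies`). In degree `0`, the elements `x ⊗ 1 - 1 ⊗ x` generate the kernel of
multiplication (`exact_augmentation`). -/

theorem dimK_eq_of_equiv {V W : Type*} [AddCommGroup V] [Module k V] [AddCommGroup W] [Module k W]
    (e : V ≃ₗ[k] W) : dimK (k := k) V = dimK (k := k) W := by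
  have h := congrArg Cardinal.toENat e.lift_rank_eq
  simpa only [dimK, Cardinal.toENat_lift] using h

variable {X Y : ℕ → Type*} [∀ i, AddCommGroup (X i)] [∀ i, Module k (X i)]
  [∀ i, AddCommGroup (Y i)] [∀ i, Module k (Y i)]
  {dX : ∀ i, X (i + 1) →ₗ[k] X i} {dY : ∀ i, Y (i + 1) →ₗ[k] Y i}

theorem map_mem_cycles {f : ∀ i, X i →ₗ[k] Y i}
    (hf : ∀ i x, dY i (f (i + 1) x) = f i (dX i x)) {i : ℕ} {x : X i} (hx : x ∈ cycles dX i) :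
    f i x ∈ cycles dY i := by
  cases i with
  | zero => exact Submodule.mem_top
  | succ i =>
    have hx' : dX i x = 0 := hx
    change dY i (f (i + 1) x) = 0
    rw [hf, hx', map_zero]

/-- The map induced on homology by a chain map. -/
def homologyMap (f : ∀ i, X i →ₗ[k] Y i) (hf : ∀ i x, dY i (f (i + 1) x) = f i (dX i x)) (i : ℕ) :
    Homology dX i →ₗ[k] Homology dY i :=
  Submodule.mapQ _ _ ((f i).restrict fun _ hx => map_mem_cycles hf hx) (by
    rintro ⟨x, hx⟩ ⟨y, hy⟩
    exact ⟨f (i + 1) y, by rw [hf, hy]; rfl⟩)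

theorem homologyMap_mk (f : ∀ i, X i →ₗ[k] Y i)
    (hf : ∀ i x, dY i (f (i + 1) x) = f i (dX i x)) (i : ℕ) (x : cycles dX i) :
    homologyMap f hf i (Submodule.Quotient.mk x)
      = Submodule.Quotient.mk ⟨f i x, map_mem_cycles hf x.2⟩ := rfl

theorem homologyMap_mem_piece {f : ∀ i, X i →ₗ[k] Y i}
    (hf : ∀ i x, dY i (f (i + 1) x) = f i (dX i x)) {grX : ∀ i, (σ →₀ ℕ) → Submodule k (X i)}
    {grY : ∀ i, (σ →₀ ℕ) → Submodule k (Y i)} (hgr : ∀ i α, ∀ x ∈ grX i α, f i x ∈ grY i α)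
    {i : ℕ} {α : σ →₀ ℕ} {z : Homology dX i} (hz : z ∈ homologyPiece dX grX i α) :
    homologyMap f hf i z ∈ homologyPiece dY grY i α := by
  obtain ⟨x, hx, rfl⟩ := hz
  exact ⟨⟨f i x, map_mem_cycles hf x.2⟩, hgr i α x hx, rfl⟩

/-- Only the values on cycles matter, so it is enough that `g ∘ f` differs from the identity by
boundaries there. A homotopy supplies this even when it ignores the multigrading. -/
theorem homologyMap_comp_eq_self {f : ∀ i, X i →ₗ[k] Y i} {g : ∀ i, Y i →ₗ[k] X i}
    (hf : ∀ i x, dY i (f (i + 1) x) = f i (dX i x))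
    (hg : ∀ i y, dX i (g (i + 1) y) = g i (dY i y))
    (hgf : ∀ i, ∀ x ∈ cycles dX i, g i (f i x) - x ∈ LinearMap.range (dX i)) (i : ℕ)
    (z : Homology dX i) : homologyMap g hg i (homologyMap f hf i z) = z := by
  obtain ⟨x, rfl⟩ := Submodule.Quotient.mk_surjective _ z
  rw [homologyMap_mk, homologyMap_mk, Submodule.Quotient.eq]
  exact hgf i x x.2

/-- Two multigraded complexes related by multigraded chain maps which are mutually inverse on
homology have the same Hilbert series of homology. -/
theorem hilbHomology_eq {f : ∀ i, X i →ₗ[k] Y i} {g : ∀ i, Y i →ₗ[k] X i}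
    (hf : ∀ i x, dY i (f (i + 1) x) = f i (dX i x))
    (hg : ∀ i y, dX i (g (i + 1) y) = g i (dY i y))
    {grX : ∀ i, (σ →₀ ℕ) → Submodule k (X i)} {grY : ∀ i, (σ →₀ ℕ) → Submodule k (Y i)}
    (hfgr : ∀ i α, ∀ x ∈ grX i α, f i x ∈ grY i α)
    (hggr : ∀ i α, ∀ y ∈ grY i α, g i y ∈ grX i α)
    (hgf : ∀ i, ∀ x ∈ cycles dX i, g i (f i x) - x ∈ LinearMap.range (dX i))
    (hfg : ∀ i, ∀ y ∈ cycles dY i, f i (g i y) - y ∈ LinearMap.range (dY i)) :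
    hilbHomology dX grX = hilbHomology dY grY := by
  funext m
  refine dimK_eq_of_equiv (LinearEquiv.ofLinearMap
    ((homologyMap f hf _).restrict fun _ hz => homologyMap_mem_piece hf hfgr hz)
    ((homologyMap g hg _).restrict fun _ hz => homologyMap_mem_piece hg hggr hz) ?_ ?_)
  · exact LinearMap.ext fun z => Subtype.ext (homologyMap_comp_eq_self hg hf hfg _ z.1)
  · exact LinearMap.ext fun z => Subtype.ext (homologyMap_comp_eq_self hf hg hgf _ z.1)

end HomologyInvariance

/-! ### Tensoring with the residue field -/

section ResidueFunctor

variable {k : Type*} [Field k] {R : Type*} [Ring R] [Algebra k R] (ε : R →ₐ[k] k)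

section

variable {M : Type*} [AddCommGroup M] [Module k M] [Module R M]

/-- The class `1 ⊗ m` in `k ⊗_R M`. -/
def residueMk : M →ₗ[k] ResidueTensor ε M :=
  (residueRel ε M).mkQ ∘ₗ TensorProduct.mk k k M 1

/-- `k ⊗[k] M` is already `M`, so maps out of `k ⊗_R M` can be compared on classes `1 ⊗ m`. -/
theorem residueMk_surjective : Function.Surjective (residueMk ε (M := M)) := by
  intro z
  obtain ⟨t, rfl⟩ := Submodule.Quotient.mk_surjective _ z
  refine ⟨TensorProduct.lid k M t, ?_⟩
  change Submodule.Quotient.mk ((TensorProduct.lid k M).symm (TensorProduct.lid k M t)) = _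
  rw [LinearEquiv.symm_apply_apply]

/-- The defining relation with `c = 1`: the ring acts through `ε`, so coefficients in `ker ε`
disappear. -/
theorem residueMk_smul (r : R) (m : M) : residueMk ε (r • m) = ε r • residueMk ε m := by
  rw [← map_smul]
  have h : (1 : k) ⊗ₜ[k] (ε r • m) - 1 ⊗ₜ[k] (r • m) ∈ residueRel ε M :=
    Submodule.subset_span ⟨1, r, m, by
      rw [one_mul, TensorProduct.tmul_smul, TensorProduct.smul_tmul', smul_eq_mul, mul_one]⟩
  exact ((Submodule.Quotient.eq _).2 h).symm

end

variable {M N : Type*} [AddCommGroup M] [Module k M] [Module R M] [IsScalarTower k R M]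
  [AddCommGroup N] [Module k N] [Module R N] [IsScalarTower k R N]

/-- The map `k ⊗_R f`, without restriction on universes. -/
def residueMap (f : M →ₗ[R] N) : ResidueTensor ε M →ₗ[k] ResidueTensor ε N :=
  Submodule.mapQ _ _ (LinearMap.lTensor k (f.restrictScalars k)) (by
    rw [residueRel, Submodule.span_le]
    rintro _ ⟨c, r, m, rfl⟩
    refine Submodule.subset_span ⟨c, r, f m, ?_⟩
    simp)

theorem residueMap_mk (f : M →ₗ[R] N) (m : M) :
    residueMap ε f (residueMk ε m) = residueMk ε (f m) := by
  simp [residueMap, residueMk]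

theorem residueMap_residueMap {L : Type*} [AddCommGroup L] [Module k L] [Module R L]
    [IsScalarTower k R L] (f : M →ₗ[R] N) (g : N →ₗ[R] L) (x : ResidueTensor ε M) :
    residueMap ε g (residueMap ε f x) = residueMap ε (g ∘ₗ f) x := by
  obtain ⟨x, rfl⟩ := residueMk_surjective ε x
  rw [residueMap_mk, residueMap_mk, residueMap_mk, LinearMap.comp_apply]

theorem ResidueTensor.map_mk {M N : Type w} [AddCommGroup M] [Module k M] [Module R M]
    [IsScalarTower k R M] [AddCommGroup N] [Module k N] [Module R N] [IsScalarTower k R N]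
    (f : M →ₗ[R] N) (m : M) :
    ResidueTensor.map ε f (residueMk ε m) = residueMk ε (f m) :=
  residueMap_mk ε f m

end ResidueFunctor

/-! ### Homotopy equivalences after tensoring with the residue field -/

section ResidueInvariance

variable {k : Type*} [Field k] {R : Type*} [Ring R] [Algebra k R] (ε : R →ₐ[k] k) {σ : Type*}
  {P : ℕ → Type w'} {Q : ℕ → Type w''} [∀ i, AddCommGroup (P i)] [∀ i, Module k (P i)] [∀ i, Module R (P i)]
  [∀ i, IsScalarTower k R (P i)] [∀ i, AddCommGroup (Q i)] [∀ i, Module k (Q i)]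
  [∀ i, Module R (Q i)] [∀ i, IsScalarTower k R (Q i)]
  {dP : ∀ i, P (i + 1) →ₗ[R] P i} {dQ : ∀ i, Q (i + 1) →ₗ[R] Q i}

theorem residueMap_comm {f : ∀ i, P i →ₗ[R] Q i} (hf : ∀ i x, dQ i (f (i + 1) x) = f i (dP i x))
    (i : ℕ) (x : ResidueTensor ε (P (i + 1))) :
    ResidueTensor.map ε (dQ i) (residueMap ε (f (i + 1)) x)
      = residueMap ε (f i) (ResidueTensor.map ε (dP i) x) := by
  obtain ⟨x, rfl⟩ := residueMk_surjective ε x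
  rw [residueMap_mk, ResidueTensor.map_mk, ResidueTensor.map_mk, residueMap_mk, hf]

theorem residueMap_mem_piece {M N : Type*} [AddCommGroup M] [Module k M] [Module R M]
    [IsScalarTower k R M] [AddCommGroup N] [Module k N] [Module R N] [IsScalarTower k R N]
    {f : M →ₗ[R] N} {p : Submodule k M} {q : Submodule k N} (hf : ∀ x ∈ p, f x ∈ q)
    (x : ResidueTensor ε M) (hx : x ∈ ResidueTensor.piece ε p) :
    residueMap ε f x ∈ ResidueTensor.piece ε q := by
  obtain ⟨m, hm, rfl⟩ := hx
  exact ⟨f m, hf m hm, (residueMap_mk ε f m).symm⟩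

/-- A chain map homotopic to the identity induces the identity on the homology of `k ⊗_R -`. -/
theorem residueMap_sub_mem_range {g : ∀ i, P i →ₗ[R] P i} {s : ∀ i, P i →ₗ[R] P (i + 1)}
    (h0 : ∀ x, g 0 x - x = dP 0 (s 0 x))
    (hs : ∀ i x, g (i + 1) x - x = dP (i + 1) (s (i + 1) x) + s i (dP i x)) (i : ℕ)
    (x : ResidueTensor ε (P i)) (hx : x ∈ cycles (k := k) (X := fun i => ResidueTensor ε (P i))
      (fun i => ResidueTensor.map ε (dP i)) i) :
    residueMap ε (g i) x - x ∈ LinearMap.range (ResidueTensor.map ε (dP i)) := by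
  obtain ⟨x, rfl⟩ := residueMk_surjective ε x
  refine ⟨residueMk ε (s i x), ?_⟩
  rw [ResidueTensor.map_mk, residueMap_mk, ← map_sub]
  cases i with
  | zero => rw [h0]
  | succ i =>
    have hx' : ResidueTensor.map ε (dP i) (residueMk ε x) = 0 := hx
    -- Although `x` itself need not be a cycle, the class of `dP i x` is zero, hence so is that of
    -- `s i (dP i x)`.
    have h := congrArg (residueMap ε (s i)) hx'
    rw [ResidueTensor.map_mk, residueMap_mk, map_zero] at h
    rw [hs, map_add, h, add_zero]

/-- Homotopy equivalent complexes have the same Hilbert series of residue homology, provided the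
chain maps (but not necessarily the homotopies) are multigraded. -/
theorem hilbResidue_eq {f : ∀ i, P i →ₗ[R] Q i} {g : ∀ i, Q i →ₗ[R] P i}
    {s : ∀ i, P i →ₗ[R] P (i + 1)} {t : ∀ i, Q i →ₗ[R] Q (i + 1)}
    (hf : ∀ i x, dQ i (f (i + 1) x) = f i (dP i x))
    (hg : ∀ i y, dP i (g (i + 1) y) = g i (dQ i y))
    {grP : ∀ i, (σ →₀ ℕ) → Submodule k (P i)} {grQ : ∀ i, (σ →₀ ℕ) → Submodule k (Q i)}
    (hfgr : ∀ i α, ∀ x ∈ grP i α, f i x ∈ grQ i α)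
    (hggr : ∀ i α, ∀ y ∈ grQ i α, g i y ∈ grP i α)
    (hs0 : ∀ x, g 0 (f 0 x) - x = dP 0 (s 0 x))
    (hs : ∀ i x, g (i + 1) (f (i + 1) x) - x = dP (i + 1) (s (i + 1) x) + s i (dP i x))
    (ht0 : ∀ y, f 0 (g 0 y) - y = dQ 0 (t 0 y))
    (ht : ∀ i y, f (i + 1) (g (i + 1) y) - y = dQ (i + 1) (t (i + 1) y) + t i (dQ i y)) :
    hilbResidue ε dP grP = hilbResidue ε dQ grQ := by
  refine hilbHomology_eq (X := fun i => ResidueTensor ε (P i)) (Y := fun i => ResidueTensor ε (Q i))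
    (f := fun i => residueMap ε (f i)) (g := fun i => residueMap ε (g i))
    (residueMap_comm ε hf) (residueMap_comm ε hg)
    (fun i α => residueMap_mem_piece ε (hfgr i α)) (fun i α => residueMap_mem_piece ε (hggr i α))
    (fun i x hx => ?_) (fun i x hx => ?_)
  · rw [residueMap_residueMap]
    exact residueMap_sub_mem_range ε (g := fun i => g i ∘ₗ f i) hs0 hs i x hx
  · rw [residueMap_residueMap]
    exact residueMap_sub_mem_range ε (g := fun i => f i ∘ₗ g i) ht0 ht i x hx

end ResidueInvariance

/-! ### Homogeneous bases -/

section HomogeneousBasis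

variable {k : Type*} [Field k] {σ : Type*} {V W J : Type*} [AddCommGroup V] [Module k V]
  [AddCommGroup W] [Module k W]

/-- The basis `v` of `V` consists of homogeneous vectors of multidegrees `deg`, for the
multigrading `gr`. -/
def IsHomogeneousBasis (gr : (σ →₀ ℕ) → Submodule k V) (v : Module.Basis J k V)
    (deg : J → σ →₀ ℕ) : Prop :=
  ∀ α, gr α = Submodule.span k (v '' {j | deg j = α})

namespace IsHomogeneousBasis

variable {gr : (σ →₀ ℕ) → Submodule k V} {v : Module.Basis J k V} {deg : J → σ →₀ ℕ}

theorem mem (h : IsHomogeneousBasis gr v deg) (j : J) : v j ∈ gr (deg j) := by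
  rw [h]
  exact Submodule.subset_span ⟨j, rfl, rfl⟩

theorem iSup_eq_top (h : IsHomogeneousBasis gr v deg) : ⨆ α, gr α = ⊤ := by
  rw [eq_top_iff, ← v.span_eq, Submodule.span_le]
  rintro _ ⟨j, rfl⟩
  exact Submodule.mem_iSup_of_mem (deg j) (h.mem j)

/-- The components are spans of disjoint parts of one basis. Together with `iSup_eq_top` this makes
`gr` a direct sum decomposition. -/
theorem iSupIndep (h : IsHomogeneousBasis gr v deg) : iSupIndep gr := by
  intro α
  have h1 : ⨆ β, ⨆ (_ : β ≠ α), gr β ≤ Submodule.span k (v '' {j | deg j ≠ α}) := by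
    refine iSup₂_le fun β hβ => ?_
    rw [h]
    refine Submodule.span_mono (Set.image_mono ?_)
    rintro j rfl
    exact hβ
  refine Disjoint.mono_right h1 ?_
  rw [h]
  refine v.linearIndependent.disjoint_span_image ?_
  rw [Set.disjoint_left]
  intro j h1 h2
  exact h2 h1

end IsHomogeneousBasis

/-- A homogeneous element in the range of a multigraded linear map has a homogeneous preimage. -/
theorem exists_homogeneous_preimage {f : V →ₗ[k] W} {grV : (σ →₀ ℕ) → Submodule k V}
    {grW : (σ →₀ ℕ) → Submodule k W} (hV : ⨆ α, grV α = ⊤) (hW : iSupIndep grW)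
    (hf : ∀ α, ∀ x ∈ grV α, f x ∈ grW α) {α : σ →₀ ℕ} {z : W} (hz : z ∈ grW α)
    (hr : ∃ x, f x = z) : ∃ x ∈ grV α, f x = z := by
  obtain ⟨x, rfl⟩ := hr
  have hx : x ∈ grV α ⊔ ⨆ β, ⨆ (_ : β ≠ α), grV β := by
    have h1 : (⊤ : Submodule k V) ≤ grV α ⊔ ⨆ β, ⨆ (_ : β ≠ α), grV β := by
      rw [← hV]
      refine iSup_le fun β => ?_
      by_cases h : β = α
      · subst h
        exact le_sup_left
      · exact le_sup_of_le_right (le_iSup₂_of_le β h le_rfl)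
    exact h1 Submodule.mem_top
  obtain ⟨y, hy, y', hy', rfl⟩ := Submodule.mem_sup.1 hx
  refine ⟨y, hy, ?_⟩
  -- The image of the part of `x` outside degree `α` lies in the other components, and also in
  -- degree `α` as a difference of two such elements. Hence it is zero.
  have h2 : f y' ∈ ⨆ β, ⨆ (_ : β ≠ α), grW β := by
    have h3 : ⨆ β, ⨆ (_ : β ≠ α), grV β ≤ (⨆ β, ⨆ (_ : β ≠ α), grW β).comap f :=
      iSup₂_le fun β hβ x hx => Submodule.mem_iSup_of_mem β (Submodule.mem_iSup_of_mem hβ (hf β x hx))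
    exact h3 hy'
  have h4 : f y' ∈ grW α := by
    have := Submodule.sub_mem _ hz (hf α y hy)
    rwa [map_add, add_sub_cancel_left] at this
  have h5 : f y' = 0 := by
    have := (hW α).le_bot ⟨h4, h2⟩
    exact this
  rw [map_add, h5, add_zero]

end HomogeneousBasis

/-! ### Graded free modules and comparison of resolutions -/

section Comparison

variable {k : Type*} [Field k] {σ : Type*} {R : Type*} [Ring R] [Algebra k R]
  (Rgr : (σ →₀ ℕ) → Submodule k R)

/-- The component of multidegree `α` of a free module with a basis of homogeneous elements. -/
def basisPiece {M B : Type*} [AddCommGroup M] [Module k M] [Module R M] (b : Module.Basis B R M)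
    (deg : B → σ →₀ ℕ) (α : σ →₀ ℕ) : Submodule k M :=
  Submodule.span k {z | ∃ c, ∃ γ, γ + deg c = α ∧ ∃ r ∈ Rgr γ, z = r • b c}

section

variable {M B J : Type*} [AddCommGroup M] [Module k M] [Module R M] [IsScalarTower k R M]
  (b : Module.Basis B R M) (deg : B → σ →₀ ℕ)

theorem freePiece_eq_basisPiece (α : σ →₀ ℕ) :
    freePiece Rgr deg α = basisPiece Rgr Finsupp.basisSingleOne deg α := by
  simp [freePiece, basisPiece]

/-- Products of a `k`-basis of `R` with the `R`-basis form a `k`-basis, and degrees add. This is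
what makes the components of a graded free module a direct sum. -/
theorem isHomogeneousBasis_smulTower {v : Module.Basis J k R} {degR : J → σ →₀ ℕ}
    (hv : IsHomogeneousBasis Rgr v degR) :
    IsHomogeneousBasis (basisPiece Rgr b deg) (v.smulTower b) fun j => degR j.1 + deg j.2 := by
  intro α
  refine le_antisymm (Submodule.span_le.2 ?_) (Submodule.span_le.2 ?_)
  · rintro _ ⟨c, γ, hγ, r, hr, rfl⟩
    rw [hv γ] at hr
    induction hr using Submodule.span_induction with
    | mem r hr =>
      obtain ⟨j, hj, rfl⟩ := hr
      refine Submodule.subset_span ⟨(j, c), ?_, by rw [Module.Basis.smulTower_apply]⟩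
      rw [← hγ, ← (hj : degR j = γ)]
      rfl
    | zero =>
      rw [zero_smul]
      exact Submodule.zero_mem _
    | add r s _ _ hr hs =>
      rw [add_smul]
      exact Submodule.add_mem _ hr hs
    | smul a r _ hr =>
      rw [smul_assoc]
      exact Submodule.smul_mem _ a hr
  · rintro _ ⟨⟨j, c⟩, hj, rfl⟩
    exact Submodule.subset_span ⟨c, degR j, hj, v j, hv.mem j, by rw [Module.Basis.smulTower_apply]⟩

variable {N : Type*} [AddCommGroup N] [Module k N] [Module R N] [IsScalarTower k R N]

/-- A linear map sending the basis elements to homogeneous elements is multigraded. -/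
theorem map_mem_of_basis {Ngr : (σ →₀ ℕ) → Submodule k N}
    (hN : ∀ α β, ∀ r ∈ Rgr α, ∀ x ∈ Ngr β, r • x ∈ Ngr (α + β)) {f : M →ₗ[R] N}
    (hf : ∀ c, f (b c) ∈ Ngr (deg c)) (α : σ →₀ ℕ) (x : M) (hx : x ∈ basisPiece Rgr b deg α) :
    f x ∈ Ngr α := by
  have h : basisPiece Rgr b deg α ≤ (Ngr α).comap (f.restrictScalars k) := by
    refine Submodule.span_le.2 ?_
    rintro _ ⟨c, γ, rfl, r, hr, rfl⟩
    change f (r • b c) ∈ Ngr _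
    rw [map_smul]
    exact hN _ _ _ hr _ (hf c)
  exact h hx

theorem smul_mem_basisPiece (hR : ∀ α β, ∀ r ∈ Rgr α, ∀ s ∈ Rgr β, r * s ∈ Rgr (α + β))
    (α β : σ →₀ ℕ) (r : R) (hr : r ∈ Rgr α) (x : M) (hx : x ∈ basisPiece Rgr b deg β) :
    r • x ∈ basisPiece Rgr b deg (α + β) := by
  have h : basisPiece Rgr b deg β ≤
      (basisPiece Rgr b deg (α + β)).comap (Algebra.lsmul k k M r) := by
    refine Submodule.span_le.2 ?_
    rintro _ ⟨c, γ, rfl, s, hs, rfl⟩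
    exact Submodule.subset_span ⟨c, α + γ, add_assoc _ _ _, r * s, hR _ _ _ hr _ hs,
      (mul_smul _ _ _).symm⟩
  exact h hx

end

variable {N : Type w''} [AddCommGroup N] [Module k N] [Module R N] [IsScalarTower k R N]

/-- `⋯ → P 1 → P 0 → N → 0` is a multigraded resolution of `N` by free modules with homogeneous
bases `b i`. -/
structure IsGradedBasisResolution (Ngr : (σ →₀ ℕ) → Submodule k N) {P : ℕ → Type w}
    [∀ i, AddCommGroup (P i)] [∀ i, Module k (P i)] [∀ i, Module R (P i)] {B : ℕ → Type*}
    (b : ∀ i, Module.Basis (B i) R (P i)) (deg : ∀ i, B i → σ →₀ ℕ)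
    (d : ∀ i, P (i + 1) →ₗ[R] P i) (aug : P 0 →ₗ[R] N) : Prop where
  aug_surjective : Function.Surjective aug
  exact_zero : Function.Exact (d 0) aug
  exact_succ : ∀ i, Function.Exact (d (i + 1)) (d i)
  aug_homogeneous : ∀ c, aug (b 0 c) ∈ Ngr (deg 0 c)
  d_homogeneous : ∀ i c, d i (b (i + 1) c) ∈ basisPiece Rgr (b i) (deg i) (deg (i + 1) c)

theorem IsMultigradedFreeResolution.isGradedBasisResolution {Ngr : (σ →₀ ℕ) → Submodule k N}
    {B : ℕ → Type*} {deg : ∀ i, B i → σ →₀ ℕ} {d : ∀ i, (B (i + 1) →₀ R) →ₗ[R] (B i →₀ R)}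
    {aug : (B 0 →₀ R) →ₗ[R] N} (h : IsMultigradedFreeResolution Rgr Ngr deg d aug) :
    IsGradedBasisResolution Rgr Ngr (fun _ => Finsupp.basisSingleOne) deg d aug where
  aug_surjective := h.aug_surjective
  exact_zero := h.exact_zero
  exact_succ := h.exact_succ
  aug_homogeneous c := by simpa using h.aug_homogeneous c
  d_homogeneous i c := by
    rw [← freePiece_eq_basisPiece]
    simpa using h.d_homogeneous i c

variable {Rgr} {Ngr : (σ →₀ ℕ) → Submodule k N}
  {P : ℕ → Type w} [∀ i, AddCommGroup (P i)] [∀ i, Module k (P i)] [∀ i, Module R (P i)]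
  [∀ i, IsScalarTower k R (P i)]
  {Q : ℕ → Type w'} [∀ i, AddCommGroup (Q i)] [∀ i, Module k (Q i)] [∀ i, Module R (Q i)]
  [∀ i, IsScalarTower k R (Q i)]
  {B C : ℕ → Type*} {b : ∀ i, Module.Basis (B i) R (P i)} {c : ∀ i, Module.Basis (C i) R (Q i)}
  {degB : ∀ i, B i → σ →₀ ℕ} {degC : ∀ i, C i → σ →₀ ℕ} {dP : ∀ i, P (i + 1) →ₗ[R] P i}
  {dQ : ∀ i, Q (i + 1) →ₗ[R] Q i} {augP : P 0 →ₗ[R] N} {augQ : Q 0 →ₗ[R] N}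

/-- Dependent recursion producing a sequence with a property of each term and a relation between
consecutive terms. -/
theorem exists_seq_of_step {T : ℕ → Type*} (G : ∀ i, T i → Prop) (Rel : ∀ i, T i → T (i + 1) → Prop)
    (t0 : T 0) (h0 : G 0 t0) (step : ∀ i t, G i t → ∃ t', G (i + 1) t' ∧ Rel i t t') :
    ∃ t : ∀ i, T i, t 0 = t0 ∧ (∀ i, G i (t i)) ∧ ∀ i, Rel i (t i) (t (i + 1)) := by
  choose f hf hr using step
  let u : ∀ i, {t : T i // G i t} := fun i =>
    Nat.rec ⟨t0, h0⟩ (fun i t => ⟨f i t.1 t.2, hf i t.1 t.2⟩) i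
  exact ⟨fun i => (u i).1, rfl, fun i => (u i).2, fun i => hr i (u i).1 (u i).2⟩

/-- The comparison theorem: a multigraded chain map over the identity of `N`. -/
theorem IsGradedBasisResolution.exists_chainMap {J : Type*} {v : Module.Basis J k R}
    {degR : J → σ →₀ ℕ} (hv : IsHomogeneousBasis Rgr v degR)
    (hR : ∀ α β, ∀ r ∈ Rgr α, ∀ s ∈ Rgr β, r * s ∈ Rgr (α + β))
    (hNind : iSupIndep Ngr) (hN : ∀ α β, ∀ r ∈ Rgr α, ∀ x ∈ Ngr β, r • x ∈ Ngr (α + β))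
    (hP : IsGradedBasisResolution Rgr Ngr b degB dP augP)
    (hQ : IsGradedBasisResolution Rgr Ngr c degC dQ augQ) :
    ∃ f : ∀ i, P i →ₗ[R] Q i, (∀ x, augQ (f 0 x) = augP x) ∧
      (∀ i x, dQ i (f (i + 1) x) = f i (dP i x)) ∧
      ∀ i α, ∀ x ∈ basisPiece Rgr (b i) (degB i) α, f i x ∈ basisPiece Rgr (c i) (degC i) α := by
  have hQtop i := (isHomogeneousBasis_smulTower Rgr (c i) (degC i) hv).iSup_eq_top
  have hQind i := (isHomogeneousBasis_smulTower Rgr (c i) (degC i) hv).iSupIndep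
  have hQmul i := smul_mem_basisPiece Rgr (c i) (degC i) hR
  have hdQ i := map_mem_of_basis Rgr (c (i + 1)) (degC (i + 1)) (hQmul i) (hQ.d_homogeneous i)
  have haQ := map_mem_of_basis Rgr (c 0) (degC 0) hN hQ.aug_homogeneous
  have h0 : ∀ j, ∃ y ∈ basisPiece Rgr (c 0) (degC 0) (degB 0 j), augQ y = augP (b 0 j) := fun j =>
    exists_homogeneous_preimage (f := augQ.restrictScalars k) (hQtop 0) hNind haQ
      (hP.aug_homogeneous j) (hQ.aug_surjective _)
  choose y0 hy0 hy0' using h0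
  have hf0 : ∀ x, augQ ((b 0).constr ℕ y0 x) = augP x := by
    intro x
    have : augQ ∘ₗ (b 0).constr ℕ y0 = augP := (b 0).ext fun j => by
      rw [LinearMap.comp_apply, Module.Basis.constr_basis, hy0']
    exact LinearMap.congr_fun this x
  obtain ⟨f, hf, hfG, hfR⟩ := exists_seq_of_step (T := fun i => P i →ₗ[R] Q i)
    -- The second half of the invariant, that `f ∘ dP i` lands in the image of `dQ i`, is what
    -- allows the next lift. At the start it comes from compatibility with the augmentations, later
    -- from exactness of `dQ`.
    (fun i f => (∀ j, f (b i j) ∈ basisPiece Rgr (c i) (degC i) (degB i j)) ∧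
      ∀ x, ∃ y, dQ i y = f (dP i x))
    (fun i f f' => ∀ x, dQ i (f' x) = f (dP i x)) ((b 0).constr ℕ y0) (by
      refine ⟨fun j => ?_, fun x => ?_⟩
      · rw [Module.Basis.constr_basis]
        exact hy0 j
      · refine (hQ.exact_zero _).1 ?_
        rw [hf0]
        exact (hP.exact_zero _).2 ⟨x, rfl⟩) (by
      rintro i f ⟨hf, hfd⟩
      have hfgr := map_mem_of_basis Rgr (b i) (degB i) (hQmul i) hf
      have h1 : ∀ j, ∃ y ∈ basisPiece Rgr (c (i + 1)) (degC (i + 1)) (degB (i + 1) j),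
          dQ i y = f (dP i (b (i + 1) j)) := fun j =>
        exists_homogeneous_preimage (f := (dQ i).restrictScalars k) (hQtop (i + 1)) (hQind i)
          (hdQ i) (hfgr _ _ (hP.d_homogeneous i j)) (hfd _)
      choose y hy hy' using h1
      have hrel : ∀ x, dQ i ((b (i + 1)).constr ℕ y x) = f (dP i x) := by
        intro x
        have : dQ i ∘ₗ (b (i + 1)).constr ℕ y = f ∘ₗ dP i := (b (i + 1)).ext fun j => by
          rw [LinearMap.comp_apply, Module.Basis.constr_basis, hy', LinearMap.comp_apply]
        exact LinearMap.congr_fun this x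
      refine ⟨(b (i + 1)).constr ℕ y, ⟨fun j => ?_, fun x => ?_⟩, hrel⟩
      · rw [Module.Basis.constr_basis]
        exact hy j
      · refine (hQ.exact_succ i _).1 ?_
        rw [hrel, (hP.exact_succ i _).2 ⟨x, rfl⟩, map_zero])
  refine ⟨f, fun x => by rw [hf, hf0], hfR, fun i => ?_⟩
  exact map_mem_of_basis Rgr (b i) (degB i) (hQmul i) (hfG i).1

/-- Chain endomorphisms over the identity of `N` are homotopic to the identity. -/
theorem IsGradedBasisResolution.exists_homotopy
    (hP : IsGradedBasisResolution Rgr Ngr b degB dP augP) {g : ∀ i, P i →ₗ[R] P i}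
    (hg0 : ∀ x, augP (g 0 x) = augP x) (hg : ∀ i x, dP i (g (i + 1) x) = g i (dP i x)) :
    ∃ s : ∀ i, P i →ₗ[R] P (i + 1), (∀ x, g 0 x - x = dP 0 (s 0 x)) ∧
      ∀ i x, g (i + 1) x - x = dP (i + 1) (s (i + 1) x) + s i (dP i x) := by
  -- Freeness used as projectivity; no degrees are controlled, since homotopies need none.
  have lift : ∀ i (φ : P i →ₗ[R] P i), (∀ x, ∃ y, dP i y = φ x) →
      ∃ s : P i →ₗ[R] P (i + 1), ∀ x, dP i (s x) = φ x := by
    intro i φ hφ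
    choose y hy using fun j => hφ (b i j)
    refine ⟨(b i).constr ℕ y, fun x => ?_⟩
    have : dP i ∘ₗ (b i).constr ℕ y = φ := (b i).ext fun j => by
      rw [LinearMap.comp_apply, Module.Basis.constr_basis, hy]
    exact LinearMap.congr_fun this x
  obtain ⟨s0, hs0⟩ := lift 0 (g 0 - LinearMap.id) fun x => (hP.exact_zero _).1 (by
    rw [LinearMap.sub_apply, map_sub, hg0]
    exact sub_self _)
  obtain ⟨s, hs, -, hsR⟩ := exists_seq_of_step (T := fun i => P i →ₗ[R] P (i + 1))
    -- The invariant says that `g - 1 - s ∘ d` in degree `i + 1` takes values in cycles, which by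
    -- exactness are boundaries.
    (fun i s => ∀ x, g i (dP i x) - dP i x - dP i (s (dP i x)) = 0)
    (fun i s s' => ∀ x, dP (i + 1) (s' x) = g (i + 1) x - x - s (dP i x)) s0 (by
      intro x
      rw [hs0]
      exact sub_self _) (by
      intro i s hs
      obtain ⟨s', hs'⟩ := lift (i + 1) (g (i + 1) - LinearMap.id - s ∘ₗ dP i) fun x =>
        (hP.exact_succ i _).1 (by
          rw [LinearMap.sub_apply, LinearMap.sub_apply, LinearMap.comp_apply, LinearMap.id_apply,
            map_sub, map_sub, hg, hs])
      refine ⟨s', fun x => ?_, hs'⟩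
      rw [hs']
      have h2 : dP i (dP (i + 1) x) = 0 := (hP.exact_succ i _).2 ⟨x, rfl⟩
      simp [h2])
  refine ⟨s, fun x => ?_, fun i x => ?_⟩
  · rw [hs, hs0]
    rfl
  · rw [hsR, sub_add_cancel]

/-- The multigraded Tor does not depend on the resolution. -/
theorem IsGradedBasisResolution.hilbResidue_eq {J : Type*} {v : Module.Basis J k R}
    {degR : J → σ →₀ ℕ} (hv : IsHomogeneousBasis Rgr v degR)
    (hR : ∀ α β, ∀ r ∈ Rgr α, ∀ s ∈ Rgr β, r * s ∈ Rgr (α + β))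
    (hNind : iSupIndep Ngr) (hN : ∀ α β, ∀ r ∈ Rgr α, ∀ x ∈ Ngr β, r • x ∈ Ngr (α + β))
    (hP : IsGradedBasisResolution Rgr Ngr b degB dP augP)
    (hQ : IsGradedBasisResolution Rgr Ngr c degC dQ augQ) (ε : R →ₐ[k] k) :
    hilbResidue ε dP (fun i => basisPiece Rgr (b i) (degB i))
      = hilbResidue ε dQ (fun i => basisPiece Rgr (c i) (degC i)) := by
  obtain ⟨f, hf0, hf, hfgr⟩ := hP.exists_chainMap hv hR hNind hN hQ
  obtain ⟨g, hg0, hg, hggr⟩ := hQ.exists_chainMap hv hR hNind hN hP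
  obtain ⟨s, hs0, hs⟩ := hP.exists_homotopy (g := fun i => g i ∘ₗ f i)
    (fun x => by rw [LinearMap.comp_apply, hg0, hf0])
    (fun i x => by rw [LinearMap.comp_apply, LinearMap.comp_apply, hg, hf])
  obtain ⟨t, ht0, ht⟩ := hQ.exists_homotopy (g := fun i => f i ∘ₗ g i)
    (fun x => by rw [LinearMap.comp_apply, hf0, hg0])
    (fun i x => by rw [LinearMap.comp_apply, LinearMap.comp_apply, hf, hg])
  exact HochschildDuality.hilbResidue_eq ε hf hg hfgr hggr hs0 hs ht0 ht

/-- The Hilbert series of the residue homology of a multigraded free resolution is the one of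
Tor. -/
theorem IsGradedBasisResolution.hilbResidue_eq_hilbTor {J : Type*} {v : Module.Basis J k R}
    {degR : J → σ →₀ ℕ} (hv : IsHomogeneousBasis Rgr v degR)
    (hR : ∀ α β, ∀ r ∈ Rgr α, ∀ s ∈ Rgr β, r * s ∈ Rgr (α + β))
    (hNind : iSupIndep Ngr) (hN : ∀ α β, ∀ r ∈ Rgr α, ∀ x ∈ Ngr β, r • x ∈ Ngr (α + β))
    (hP : IsGradedBasisResolution Rgr Ngr b degB dP augP) {D : ℕ → Type*} {deg : ∀ i, D i → σ →₀ ℕ}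
    {d : ∀ i, (D (i + 1) →₀ R) →ₗ[R] (D i →₀ R)} {aug : (D 0 →₀ R) →ₗ[R] N}
    (hQ : IsMultigradedFreeResolution Rgr Ngr deg d aug) (ε : R →ₐ[k] k) :
    hilbResidue ε dP (fun i => basisPiece Rgr (b i) (degB i)) = hilbTor ε Rgr deg d := by
  rw [hP.hilbResidue_eq hv hR hNind hN hQ.isGradedBasisResolution, hilbTor]
  congr 1
  funext i α
  exact (freePiece_eq_basisPiece _ _ _).symm

end Comparison

/-- A module over a `k`-algebra with a `k`-basis made of the products of a `k`-basis of the algebra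
with a family of elements is free on that family. -/
theorem exists_basis_of_smul {k R M J C L : Type*} [Field k] [Ring R] [Algebra k R] [AddCommGroup M]
    [Module k M] [Module R M] [IsScalarTower k R M] (w : Module.Basis J k R)
    (u : Module.Basis L k M) (m : C → M) (e : J × C ≃ L) (h : ∀ j c, w j • m c = u (e (j, c))) :
    ∃ b : Module.Basis C R M, ∀ c, b c = m c := by
  let f : (C →₀ R) →ₗ[R] M := Finsupp.linearCombination R m
  let e' : (C →₀ R) ≃ₗ[k] M := (w.smulTower Finsupp.basisSingleOne).equiv u e
  have he : f.restrictScalars k = e'.toLinearMap := by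
    refine (w.smulTower Finsupp.basisSingleOne).ext fun j => ?_
    rw [LinearEquiv.coe_coe, Module.Basis.equiv_apply, LinearMap.restrictScalars_apply,
      Module.Basis.smulTower_apply, map_smul, Finsupp.coe_basisSingleOne,
      Finsupp.linearCombination_single, one_smul, h]
  have hf : (f : _ → _) = e' := funext fun z => LinearMap.congr_fun he z
  have hb : Function.Bijective f := by
    rw [hf]
    exact e'.bijective
  refine ⟨.ofRepr (LinearEquiv.ofBijective f hb).symm, fun c => ?_⟩
  change f (Finsupp.single c 1) = _
  rw [Finsupp.linearCombination_single, one_smul]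

/-! ### Multigradings of an algebra and its enveloping algebra -/

section AlgebraGrading

variable {k : Type u} [Field k] {A : Type v} [Ring A] [Algebra k A] {σ : Type*} {x : σ → A}

theorem one_mem_algPiece : (1 : A) ∈ algPiece (k := k) x 0 :=
  Submodule.subset_span ⟨[], by simp, by simp⟩

theorem generator_mem_algPiece (s : σ) : x s ∈ algPiece (k := k) x (Finsupp.single s 1) :=
  Submodule.subset_span ⟨[s], by simp, by simp⟩

theorem mul_mem_algPiece {α β : σ →₀ ℕ} {a b : A} (ha : a ∈ algPiece (k := k) x α)
    (hb : b ∈ algPiece (k := k) x β) : a * b ∈ algPiece (k := k) x (α + β) := by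
  have h := Submodule.mul_mem_mul ha hb
  rw [algPiece, algPiece, Submodule.span_mul_span] at h
  refine Submodule.span_mono ?_ h
  rintro _ ⟨_, ⟨l, rfl, rfl⟩, _, ⟨l', rfl, rfl⟩, rfl⟩
  exact ⟨l ++ l', by simp, by simp⟩

theorem tmul_mem_envPiece {α β : σ →₀ ℕ} {a b : A} (ha : a ∈ algPiece (k := k) x α)
    (hb : b ∈ algPiece (k := k) x β) :
    (a ⊗ₜ[k] MulOpposite.op b : Env k A) ∈ envPiece (k := k) x (α + β) :=
  Submodule.subset_span ⟨α, β, rfl, a, ha, b, hb, rfl⟩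

theorem one_mem_envPiece : (1 : Env k A) ∈ envPiece (k := k) x 0 := by
  have h := tmul_mem_envPiece (one_mem_algPiece (k := k) (x := x)) one_mem_algPiece
  rwa [add_zero] at h

theorem mul_mem_envPiece (α β : σ →₀ ℕ) (r : Env k A) (hr : r ∈ envPiece (k := k) x α)
    (s : Env k A) (hs : s ∈ envPiece (k := k) x β) : r * s ∈ envPiece (k := k) x (α + β) := by
  have h := Submodule.mul_mem_mul hr hs
  rw [envPiece, envPiece, Submodule.span_mul_span] at h
  refine Submodule.span_le.2 ?_ h
  rintro _ ⟨_, ⟨α₁, α₂, rfl, a, ha, b, hb, rfl⟩, _, ⟨β₁, β₂, rfl, c, hc, d, hd, rfl⟩, rfl⟩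
  -- The second factors are multiplied in `Aᵒᵖ`, hence `d * b` and not `b * d`.
  have := tmul_mem_envPiece (mul_mem_algPiece ha hc) (mul_mem_algPiece hd hb)
  have e : α₁ + α₂ + (β₁ + β₂) = α₁ + β₁ + (β₂ + α₂) := by abel
  simpa [e] using this

instance envScalarTowerSelf : IsScalarTower k (Env k A) A where
  smul_assoc c r m := by
    induction r using TensorProduct.induction_on with
    | zero => rw [smul_zero, zero_smul (Env k A) m, smul_zero]
    | tmul a b =>
      rw [TensorProduct.smul_tmul', env_tmul_smul, env_tmul_smul, smul_mul_assoc, smul_mul_assoc]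
    | add r s hr hs =>
      rw [smul_add, add_smul (c • r : Env k A) (c • s) m, hr, hs, add_smul (r : Env k A) s m,
        smul_add]

theorem smul_mem_algPiece (α β : σ →₀ ℕ) (r : Env k A) (hr : r ∈ envPiece (k := k) x α)
    (m : A) (hm : m ∈ algPiece (k := k) x β) : r • m ∈ algPiece (k := k) x (α + β) := by
  induction hr using Submodule.span_induction with
  | mem r hr =>
    obtain ⟨α₁, α₂, rfl, a, ha, b, hb, rfl⟩ := hr
    have := mul_mem_algPiece (mul_mem_algPiece ha hm) hb
    have e : α₁ + α₂ + β = α₁ + β + α₂ := by abel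
    simpa [e, env_tmul_smul] using this
  | zero =>
    rw [zero_smul (Env k A) m]
    exact Submodule.zero_mem _
  | add r s _ _ hr hs =>
    rw [add_smul (r : Env k A) s m]
    exact Submodule.add_mem _ hr hs
  | smul c r _ hr =>
    rw [smul_assoc]
    exact Submodule.smul_mem _ c hr

variable {ι : Type*} {v : Module.Basis ι k A} {deg : ι → σ →₀ ℕ}

/-- The basis of the enveloping algebra given by a basis of the algebra. -/
def envBasis (v : Module.Basis ι k A) : Module.Basis (ι × ι) k (Env k A) :=
  v.tensorProduct (v.map (MulOpposite.opLinearEquiv k))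

theorem envBasis_apply (j : ι × ι) :
    envBasis v j = v j.1 ⊗ₜ[k] MulOpposite.op (v j.2) := by
  simp [envBasis, Module.Basis.tensorProduct_apply']

theorem isHomogeneousBasis_envBasis (hv : IsHomogeneousBasis (algPiece (k := k) x) v deg) :
    IsHomogeneousBasis (envPiece (k := k) x) (envBasis v) fun j => deg j.1 + deg j.2 := by
  intro α
  refine le_antisymm (Submodule.span_le.2 ?_) (Submodule.span_le.2 ?_)
  · rintro _ ⟨β, γ, rfl, a, ha, b, hb, rfl⟩
    have h : a ⊗ₜ[k] MulOpposite.op b ∈ Submodule.map₂ (TensorProduct.mk k A Aᵐᵒᵖ)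
        (algPiece (k := k) x β)
        ((algPiece (k := k) x γ).map (MulOpposite.opLinearEquiv k).toLinearMap) :=
      Submodule.apply_mem_map₂ _ ha ⟨b, hb, rfl⟩
    rw [hv, hv, Submodule.map_span, Submodule.map₂_span_span] at h
    refine Submodule.span_mono ?_ h
    rintro _ ⟨_, ⟨j, rfl, rfl⟩, _, ⟨_, ⟨j', rfl, rfl⟩, rfl⟩, rfl⟩
    exact ⟨(j, j'), rfl, envBasis_apply _⟩
  · rintro _ ⟨j, rfl, rfl⟩
    rw [envBasis_apply]
    exact tmul_mem_envPiece (hv.mem _) (hv.mem _)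

end AlgebraGrading

/-! ### The Hochschild complex as a graded free resolution -/

section HochschildResolution

variable {k : Type u} [Field k] {A : Type v} [Ring A] [Algebra k A]

/-- The extra degeneracy `a ↦ 1 ⊗ a`. -/
def HC.extra (i : ℕ) : HC k A i →ₗ[k] HC k A (i + 1) :=
  PiTensorProduct.lift ((HC.tprod k (i + 1) (A := A)).curryLeft 1)

theorem HC.extra_tprod (i : ℕ) (a : Fin (i + 2) → A) :
    HC.extra i (HC.tprod k i a) = HC.tprod k (i + 1) (Fin.cons 1 a) :=
  PiTensorProduct.lift.tprod a

/-- The multiplication `A ⊗ A → A` as a `k`-linear map. -/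
def HC.augLin : HC k A 0 →ₗ[k] A := PiTensorProduct.lift (MultilinearMap.mkPiAlgebraFin k 2 A)

theorem HC.augLin_tprod (a : Fin 2 → A) : HC.augLin (HC.tprod k 0 a) = a 0 * a 1 := by
  have h : HC.augLin (HC.tprod k 0 a) = MultilinearMap.mkPiAlgebraFin k 2 A a :=
    PiTensorProduct.lift.tprod a
  rw [h, MultilinearMap.mkPiAlgebraFin_apply]
  simp

theorem HC.augLin_smul (r : Env k A) (m : HC k A 0) : HC.augLin (r • m) = r • HC.augLin m := by
  induction r using TensorProduct.induction_on with
  | zero =>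
    rw [zero_smul (Env k A) m, zero_smul (Env k A) (HC.augLin m), map_zero]
  | add r s hr hs =>
    rw [add_smul (r : Env k A) s m, add_smul (r : Env k A) s (HC.augLin m), map_add, hr, hs]
  | tmul x y =>
    suffices h : HC.augLin ∘ₗ HC.act k A 0 (x ⊗ₜ[k] y)
        = (Algebra.lsmul k k A (x ⊗ₜ[k] y : Env k A)) ∘ₗ HC.augLin from LinearMap.congr_fun h m
    refine HC.hom_ext fun a => ?_
    rw [LinearMap.comp_apply, ← HC.smul_def, HC.tmul_smul_tprod, HC.augLin_tprod,
      LinearMap.comp_apply, HC.augLin_tprod, Algebra.lsmul_coe]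
    dsimp only
    rw [env_tmul_smul]
    simp [mul_assoc]

variable (k A)

/-- The multiplication `A ⊗ A → A`, the augmentation of the Hochschild complex. -/
def HC.aug : HC k A 0 →ₗ[Env k A] A where
  toFun := HC.augLin
  map_add' := map_add _
  map_smul' := HC.augLin_smul

variable {k A}

/-- The map `a ↦ 1 ⊗ a` from `A` to `A ⊗ A`. -/
def HC.unitTensor : A →ₗ[k] HC k A 0 where
  toFun a := HC.tprod k 0 ![1, a]
  map_add' a b := by
    have h : ∀ c : A, (![1, c] : Fin 2 → A) = Function.update ![1, 0] 1 c := by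
      intro c; funext l; fin_cases l <;> rfl
    rw [h, h a, h b, MultilinearMap.map_update_add]
  map_smul' c a := by
    have h : ∀ c : A, (![1, c] : Fin 2 → A) = Function.update ![1, 0] 1 c := by
      intro c; funext l; fin_cases l <;> rfl
    rw [h, h a, MultilinearMap.map_update_smul]
    rfl

/-- Of the two faces of `1 ⊗ a`, the first absorbs the `1` and returns `a`; the second gives `-(1 ⊗
a 0 * a 1)`. -/
theorem HC.d_extra_zero (m : HC k A 0) :
    HC.d k A 0 (HC.extra 0 m) = m - HC.unitTensor (HC.aug k A m) := by
  suffices h : HC.dLin 0 ∘ₗ HC.extra 0 = LinearMap.id - HC.unitTensor ∘ₗ HC.augLin (k := k) (A := A)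
    from LinearMap.congr_fun h m
  refine HC.hom_ext fun a => ?_
  rw [LinearMap.comp_apply, HC.extra_tprod, HC.dLin_tprod, Fin.sum_univ_two, LinearMap.sub_apply,
    LinearMap.comp_apply, HC.augLin_tprod]
  have h0 : Fin.contractNth (Fin.castSucc (0 : Fin 2)) (· * ·) (Fin.cons 1 a : Fin 3 → A) = a := by
    funext l; fin_cases l <;> (simp [Fin.contractNth]; try rfl)
  have h1 : Fin.contractNth (Fin.castSucc (1 : Fin 2)) (· * ·) (Fin.cons 1 a : Fin 3 → A)
      = ![1, a 0 * a 1] := by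
    funext l; fin_cases l <;> (simp [Fin.contractNth]; try rfl)
  rw [h0, h1]
  simp [HC.unitTensor, sub_eq_add_neg]

/-- Face `0` of `1 ⊗ a` is `a`, while face `j + 1` is `1 ⊗` (face `j` of `a`); the index shift
produces the sign. So `extra` is a contracting homotopy, and `k`-linearity is all that exactness
asks of it. -/
theorem HC.d_extra_succ (i : ℕ) (m : HC k A (i + 1)) :
    HC.d k A (i + 1) (HC.extra (i + 1) m) = m - HC.extra i (HC.d k A i m) := by
  suffices h : HC.dLin (i + 1) ∘ₗ HC.extra (i + 1)
      = LinearMap.id - HC.extra i ∘ₗ HC.dLin (k := k) (A := A) i from LinearMap.congr_fun h m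
  refine HC.hom_ext fun a => ?_
  rw [LinearMap.comp_apply, HC.extra_tprod, HC.dLin_tprod, Fin.sum_univ_succ, LinearMap.sub_apply,
    LinearMap.comp_apply, HC.dLin_tprod, map_sum, sub_eq_add_neg, ← Finset.sum_neg_distrib]
  have h0 : Fin.contractNth (Fin.castSucc (0 : Fin (i + 3))) (· * ·)
      (Fin.cons 1 a : Fin (i + 4) → A) = a := by
    funext l
    rcases Fin.eq_zero_or_eq_succ l with rfl | ⟨l, rfl⟩
    · simp [Fin.contractNth]
    · simp [Fin.contractNth]
  have h1 : ∀ j : Fin (i + 2), Fin.contractNth (Fin.castSucc j.succ) (· * ·)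
      (Fin.cons 1 a : Fin (i + 4) → A) = Fin.cons 1 (Fin.contractNth j.castSucc (· * ·) a) := by
    intro j
    funext l
    rcases Fin.eq_zero_or_eq_succ l with rfl | ⟨l, rfl⟩
    · simp [Fin.contractNth]
    · simp [Fin.contractNth]
  congr 1
  · rw [h0]; simp
  · refine Finset.sum_congr rfl fun j _ => ?_
    rw [h1, map_smul, HC.extra_tprod, Fin.val_succ, pow_succ, mul_neg_one, neg_smul]

/-- `A^{⊗ (i + 3)}` is generated by the tensors with first entry `1`. -/
theorem HC.eq_zero_of_extra {i : ℕ} {M : Type*} [AddCommGroup M] [Module k M] [Module (Env k A) M]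
    [IsScalarTower k (Env k A) M]
    {f : HC k A (i + 1) →ₗ[Env k A] M} (hf : ∀ m, f (HC.extra i m) = 0) (m : HC k A (i + 1)) :
    f m = 0 := by
  suffices h : f.restrictScalars k = 0 from LinearMap.congr_fun h m
  refine HC.hom_ext fun a => ?_
  have h : HC.tprod k (i + 1) a
      = (a 0 ⊗ₜ[k] 1 : Env k A) • HC.extra i (HC.tprod k i (Fin.tail a)) := by
    rw [HC.extra_tprod, HC.tmul_smul_tprod]
    congr 1
    funext l
    rcases Fin.eq_zero_or_eq_succ l with rfl | ⟨l, rfl⟩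
    · simp
    · simp [Fin.tail]
  rw [h]
  change f (_ • _) = 0
  rw [map_smul, hf, smul_zero]

theorem HC.aug_d (m : HC k A 1) : HC.aug k A (HC.d k A 0 m) = 0 := by
  refine HC.eq_zero_of_extra (f := HC.aug k A ∘ₗ HC.d k A 0) (fun m => ?_) m
  rw [LinearMap.comp_apply, HC.d_extra_zero, map_sub, sub_eq_zero]
  change _ = HC.augLin (HC.tprod k 0 ![1, _])
  rw [HC.augLin_tprod]
  simp

/-- No simplicial identities are needed. On generators `1 ⊗ m` the homotopy relation, used twice,
turns `d d (1 ⊗ m)` into `1 ⊗ d d m`, which vanishes by induction; at the bottom `aug d m` takes the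
place of `d d m`. -/
theorem HC.d_d (i : ℕ) (m : HC k A (i + 2)) : HC.d k A i (HC.d k A (i + 1) m) = 0 := by
  induction i with
  | zero =>
    refine HC.eq_zero_of_extra (f := HC.d k A 0 ∘ₗ HC.d k A 1) (fun m => ?_) m
    rw [LinearMap.comp_apply, HC.d_extra_succ, map_sub, HC.d_extra_zero, HC.aug_d, map_zero,
      sub_zero, sub_self]
  | succ i ih =>
    refine HC.eq_zero_of_extra (f := HC.d k A (i + 1) ∘ₗ HC.d k A (i + 2)) (fun m => ?_) m
    rw [LinearMap.comp_apply, HC.d_extra_succ, map_sub, HC.d_extra_succ, ih, map_zero,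
      sub_zero, sub_self]

theorem HC.exact_zero : Function.Exact (HC.d k A 0) (HC.aug k A) := by
  refine fun m => ⟨fun hm => ⟨HC.extra 0 m, ?_⟩, ?_⟩
  · rw [HC.d_extra_zero, hm, map_zero, sub_zero]
  · rintro ⟨m, rfl⟩
    exact HC.aug_d m

theorem HC.exact_succ (i : ℕ) : Function.Exact (HC.d k A (i + 1)) (HC.d k A i) := by
  refine fun m => ⟨fun hm => ⟨HC.extra (i + 1) m, ?_⟩, ?_⟩
  · rw [HC.d_extra_succ, hm, map_zero, sub_zero]
  · rintro ⟨m, rfl⟩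
    exact HC.d_d i m

theorem HC.aug_surjective : Function.Surjective (HC.aug k A) := fun a =>
  ⟨HC.unitTensor a, by
    change HC.augLin (HC.tprod k 0 ![1, a]) = a
    rw [HC.augLin_tprod]
    simp⟩

end HochschildResolution

/-! ### Bases of the Hochschild complex -/

section HochschildBasis

variable {k : Type u} [Field k] {A : Type v} [Ring A] [Algebra k A] {ι : Type*}
  (v : Module.Basis ι k A)

/-- The basis of `A^{⊗ (i + 2)}` over `k` given by a basis of `A`. -/
def HC.vectorBasis (i : ℕ) : Module.Basis (Fin (i + 2) → ι) k (HC k A i) :=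
  Basis.piTensorProduct fun _ : Fin (i + 2) => v

theorem HC.vectorBasis_apply {i : ℕ} (c : Fin (i + 2) → ι) :
    HC.vectorBasis v i c = HC.tprod k i fun l => v (c l) :=
  Basis.piTensorProduct_apply (fun _ : Fin (i + 2) => v) c

theorem HC.vectorBasis_repr_tprod {i : ℕ} (a : Fin (i + 2) → A) (c : Fin (i + 2) → ι) :
    (HC.vectorBasis v i).repr (HC.tprod k i a) c = ∏ l, v.repr (a l) (c l) :=
  Basis.piTensorProduct_repr_tprod_apply (fun _ : Fin (i + 2) => v) a c

theorem HC.isHomogeneousBasis_vectorBasis {σ : Type*} {x : σ → A} {deg : ι → σ →₀ ℕ}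
    (hv : IsHomogeneousBasis (algPiece (k := k) x) v deg) (i : ℕ) :
    IsHomogeneousBasis (HC.piece x i) (HC.vectorBasis v i) fun c => ∑ l, deg (c l) := by
  intro α
  refine le_antisymm (Submodule.span_le.2 ?_) (Submodule.span_le.2 ?_)
  · rintro _ ⟨β, rfl, a, ha, rfl⟩
    refine (Module.Basis.mem_span_image _).2 fun c hc => ?_
    -- A coordinate of a pure tensor is the product of the coordinates of its entries. If it is
    -- nonzero, every factor is, and homogeneity of `a l` forces `deg (c l) = β l`.
    have hc' : ∏ l, v.repr (a l) (c l) ≠ 0 := by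
      rw [← HC.vectorBasis_repr_tprod]
      exact Finsupp.mem_support_iff.1 hc
    rw [Finset.prod_ne_zero_iff] at hc'
    refine Finset.sum_congr rfl fun l _ => ?_
    have h := ha l
    rw [hv, Module.Basis.mem_span_image] at h
    exact h (Finsupp.mem_support_iff.2 (hc' l (Finset.mem_univ l)))
  · rintro _ ⟨c, rfl, rfl⟩
    exact Submodule.subset_span ⟨fun l => deg (c l), rfl, fun l => v (c l), fun l => hv.mem _,
      HC.vectorBasis_apply v c⟩

/-- Words of length `i + 2` as words of length `i` together with a first and a last letter. -/
def wordEquiv (ι : Type*) (i : ℕ) : (ι × ι) × (Fin i → ι) ≃ (Fin (i + 2) → ι) where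
  toFun j := Fin.cons j.1.1 (Fin.snoc j.2 j.1.2 : Fin (i + 1) → ι)
  invFun c := ((c 0, c (Fin.last (i + 1))), fun l => c l.castSucc.succ)
  left_inv j := by
    rcases j with ⟨⟨a, b⟩, c⟩
    simp [← Fin.succ_last]
  right_inv c := by
    funext l
    rcases Fin.eq_zero_or_eq_succ l with rfl | ⟨l, rfl⟩
    · simp
    · rcases Fin.eq_castSucc_or_eq_last l with ⟨l, rfl⟩ | rfl
      · simp
      · simp

/-- Acting by `v a ⊗ v b` fills the two outer slots of `1 ⊗ ⋯ ⊗ 1`. Hence the words in the basis of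
`A` are the products of a basis of `A ⊗ Aᵒᵖ` with the inner words, and the bar complex is free. -/
theorem tprod_word {i : ℕ} (a b : ι) (c : Fin i → ι) :
    (v a ⊗ₜ[k] MulOpposite.op (v b) : Env k A) •
      HC.tprod k i (Fin.cons 1 (Fin.snoc (fun l => v (c l)) 1 : Fin (i + 1) → A))
      = HC.vectorBasis v i (wordEquiv ι i ((a, b), c)) := by
  rw [HC.tmul_smul_tprod, HC.vectorBasis_apply]
  congr 1
  funext l
  rcases Fin.eq_zero_or_eq_succ l with rfl | ⟨l, rfl⟩
  · simp [wordEquiv, ← Fin.succ_last, (Fin.succ_ne_zero _).symm]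
  · rcases Fin.eq_castSucc_or_eq_last l with ⟨l, rfl⟩ | rfl
    · simp [wordEquiv, ← Fin.succ_last]
    · simp [wordEquiv, ← Fin.succ_last]

theorem HC.exists_basis (i : ℕ) : ∃ b : Module.Basis (Fin i → ι) (Env k A) (HC k A i), ∀ c,
    b c = HC.tprod k i (Fin.cons 1 (Fin.snoc (fun l => v (c l)) 1 : Fin (i + 1) → A)) :=
  exists_basis_of_smul (envBasis v) (HC.vectorBasis v i) _ (wordEquiv ι i) fun j c => by
    rw [envBasis_apply]
    exact tprod_word v _ _ _

/-- The basis of `A^{⊗ (i + 2)}` over `A ⊗ Aᵒᵖ` given by a basis of `A`. -/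
def HC.basis (i : ℕ) : Module.Basis (Fin i → ι) (Env k A) (HC k A i) :=
  (HC.exists_basis v i).choose

theorem HC.basis_apply {i : ℕ} (c : Fin i → ι) : HC.basis v i c =
    HC.tprod k i (Fin.cons 1 (Fin.snoc (fun l => v (c l)) 1 : Fin (i + 1) → A)) :=
  (HC.exists_basis v i).choose_spec c

/-! ### Multidegrees on the bar complex -/

variable {v} {σ : Type*} {x : σ → A} {deg : ι → σ →₀ ℕ}

/-- Both gradings are spanned by the same `k`-basis of words, and splitting off the two outer
letters does not change the total degree. -/
theorem HC.basisPiece_eq_piece (hv : IsHomogeneousBasis (algPiece (k := k) x) v deg) (i : ℕ)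
    (α : σ →₀ ℕ) :
    basisPiece (envPiece (k := k) x) (HC.basis v i) (fun c => ∑ l, deg (c l)) α
      = HC.piece x i α := by
  rw [isHomogeneousBasis_smulTower _ (HC.basis v i) _ (isHomogeneousBasis_envBasis hv) α,
    HC.isHomogeneousBasis_vectorBasis v hv i α]
  have h1 : ∀ j, ((envBasis v).smulTower (HC.basis v i)) j
      = HC.vectorBasis v i (wordEquiv ι i j) := by
    intro j
    rw [Module.Basis.smulTower_apply, envBasis_apply, HC.basis_apply]
    exact tprod_word v _ _ _
  have h2 : ∀ j : (ι × ι) × (Fin i → ι), deg j.1.1 + deg j.1.2 + ∑ l, deg (j.2 l)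
      = ∑ l, deg (wordEquiv ι i j l) := by
    intro j
    rw [Fin.sum_univ_succ, Fin.sum_univ_castSucc]
    simp only [wordEquiv, Equiv.coe_fn_mk, Fin.cons_zero, Fin.cons_succ, Fin.snoc_castSucc,
      Fin.snoc_last]
    abel
  congr 1
  ext z
  constructor
  · rintro ⟨j, hj, rfl⟩
    exact ⟨wordEquiv ι i j, (h2 j).symm.trans hj, (h1 j).symm⟩
  · rintro ⟨c, hc, rfl⟩
    refine ⟨(wordEquiv ι i).symm c, (h2 _).trans ?_, ?_⟩
    · rw [Equiv.apply_symm_apply]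
      exact hc
    · rw [h1, Equiv.apply_symm_apply]

/-- Merging two neighbouring entries keeps the sum. Applied to the degrees of the entries, it shows
that each face map preserves multidegree. -/
theorem sum_contractNth {M : Type*} [AddCommMonoid M] {n : ℕ} (j : Fin n) (b : Fin (n + 1) → M) :
    ∑ l, Fin.contractNth j.castSucc (· + ·) b l = ∑ l, b l := by
  induction n with
  | zero => exact j.elim0
  | succ n ih =>
    rw [Fin.sum_univ_succ (n := n + 1), Fin.sum_univ_succ (n := n)]
    rcases Fin.eq_zero_or_eq_succ j with rfl | ⟨j, rfl⟩
    · simp [Fin.contractNth, Fin.sum_univ_succ (n := n), add_assoc]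
    · rw [← ih j (fun l => b l.succ)]
      simp [Fin.contractNth]

theorem HC.tprod_mem_piece {i : ℕ} {a : Fin (i + 2) → A} {β : Fin (i + 2) → σ →₀ ℕ}
    (ha : ∀ l, a l ∈ algPiece (k := k) x (β l)) : HC.tprod k i a ∈ HC.piece x i (∑ l, β l) :=
  Submodule.subset_span ⟨β, rfl, a, ha, rfl⟩

theorem HC.d_mem_piece (i : ℕ) (α : σ →₀ ℕ) (m : HC k A (i + 1)) (hm : m ∈ HC.piece x (i + 1) α) :
    HC.d k A i m ∈ HC.piece x i α := by
  have h : HC.piece x (i + 1) α ≤ (HC.piece (k := k) x i α).comap (HC.dLin i) := by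
    refine Submodule.span_le.2 ?_
    rintro _ ⟨β, rfl, a, ha, rfl⟩
    rw [SetLike.mem_coe, Submodule.mem_comap, HC.dLin_tprod]
    refine Submodule.sum_mem _ fun j _ => Submodule.smul_mem _ _ ?_
    rw [← sum_contractNth j]
    refine HC.tprod_mem_piece fun l => ?_
    simp only [Fin.contractNth]
    split_ifs
    · exact ha _
    · exact mul_mem_algPiece (ha _) (ha _)
    · exact ha _
  exact h hm

theorem HC.isGradedBasisResolution (hv : IsHomogeneousBasis (algPiece (k := k) x) v deg) :
    IsGradedBasisResolution (envPiece (k := k) x) (algPiece (k := k) x) (HC.basis v)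
      (fun _ c => ∑ l, deg (c l)) (HC.d k A) (HC.aug k A) where
  aug_surjective := HC.aug_surjective
  exact_zero := HC.exact_zero
  exact_succ := HC.exact_succ
  aug_homogeneous c := by
    change HC.augLin _ ∈ _
    have h : (Fin.cons 1 (Fin.snoc (fun l => v (c l)) 1 : Fin 1 → A) : Fin 2 → A) 1 = 1 := rfl
    rw [HC.basis_apply, HC.augLin_tprod, h, mul_one]
    simpa using one_mem_algPiece
  d_homogeneous i c := by
    rw [HC.basisPiece_eq_piece hv]
    refine HC.d_mem_piece i _ _ ?_
    rw [← HC.basisPiece_eq_piece hv]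
    exact Submodule.subset_span ⟨c, 0, zero_add _, 1,
      one_mem_envPiece,
      (one_smul _ _).symm⟩

/-- Hochschild homology with coefficients in `k` is the multigraded Tor. -/
theorem hilbHH_eq_hilbTor (hv : IsHomogeneousBasis (algPiece (k := k) x) v deg)
    (ε : A →ₐ[k] k) {B : ℕ → Type*} {degB : ∀ i, B i → σ →₀ ℕ}
    {d : ∀ i, (B (i + 1) →₀ Env k A) →ₗ[Env k A] (B i →₀ Env k A)}
    {aug : (B 0 →₀ Env k A) →ₗ[Env k A] A}
    (hP : IsMultigradedFreeResolution (envPiece (k := k) x) (algPiece (k := k) x) degB d aug) :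
    hilbHH ε x = hilbTor (envAug ε) (envPiece (k := k) x) degB d := by
  have h := (HC.isGradedBasisResolution hv).hilbResidue_eq_hilbTor
    (isHomogeneousBasis_envBasis hv) (fun α β r hr s hs => mul_mem_envPiece α β r hr s hs)
    hv.iSupIndep (fun α β r hr m hm => smul_mem_algPiece α β r hr m hm) hP (envAug ε)
  rw [← h, hilbHH]
  congr 1
  funext i α
  exact (HC.basisPiece_eq_piece hv i α).symm

end HochschildBasis

/-! ### Tor from a minimal resolution -/

section Minimal

variable {k : Type*} [Field k] {σ : Type*} {R : Type*} [Ring R] [Algebra k R] (ε : R →ₐ[k] k)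

/-- `k ⊗_R R^(B) → k^(B)`. -/
def residueCoord (B : Type*) : ResidueTensor ε (B →₀ R) →ₗ[k] (B →₀ k) :=
  Submodule.liftQ _
    (TensorProduct.lift (LinearMap.lsmul k _ |>.compl₂ (Finsupp.mapRange.linearMap ε.toLinearMap)))
    (by
      rw [residueRel, Submodule.span_le]
      rintro _ ⟨c, r, m, rfl⟩
      rw [SetLike.mem_coe, LinearMap.mem_ker, map_sub, sub_eq_zero]
      ext b
      simp [mul_assoc])

theorem residueCoord_mk {B : Type*} (f : B →₀ R) (b : B) :
    residueCoord ε B (residueMk ε f) b = ε (f b) := by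
  simp [residueCoord, residueMk]

theorem residueMk_single {B : Type*} (b : B) (r : R) :
    residueMk ε (Finsupp.single b r) = ε r • residueMk ε (Finsupp.single b (1 : R)) := by
  rw [← residueMk_smul, Finsupp.smul_single, smul_eq_mul, mul_one]

theorem residueMk_eq_zero {B : Type*} {f : B →₀ R} (hf : ∀ b, ε (f b) = 0) :
    residueMk ε f = 0 := by
  rw [← Finsupp.sum_single f, Finsupp.sum, map_sum]
  refine Finset.sum_eq_zero fun b _ => ?_
  rw [residueMk_single, hf, zero_smul]

variable {ε}

/-- The multigraded Tor computed by a minimal complex counts its basis elements. -/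
theorem hilbTor_of_isMinimal {Rgr : (σ →₀ ℕ) → Submodule k R} (h1 : (1 : R) ∈ Rgr 0)
    (hε : ∀ γ ≠ 0, ∀ r ∈ Rgr γ, ε r = 0) {B : ℕ → Type*} {deg : ∀ i, B i → σ →₀ ℕ}
    {d : ∀ i, (B (i + 1) →₀ R) →ₗ[R] (B i →₀ R)} (hd : IsMinimal ε d) (m : Option σ →₀ ℕ) :
    hilbTor ε Rgr deg d m = ENat.card {b : B (m none) // deg _ b = m.some} := by
  -- Minimality kills every coefficient, so all elements are cycles and the homology is the complex
  -- itself.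
  have hzero : ∀ i, ResidueTensor.map ε (d i) = 0 := by
    intro i
    refine LinearMap.ext fun x => ?_
    obtain ⟨x, rfl⟩ := residueMk_surjective ε x
    rw [ResidueTensor.map_mk, residueMk_eq_zero ε (hd i x), LinearMap.zero_apply]
  change dimK (k := k) (homologyPiece (X := fun i => ResidueTensor ε (B i →₀ R))
    (fun i => ResidueTensor.map ε (d i))
    (fun i α => ResidueTensor.piece ε (freePiece Rgr (deg i) α)) (m none) m.some) = _
  generalize m none = i
  generalize m.some = α
  set D : ∀ i, ResidueTensor ε (B (i + 1) →₀ R) →ₗ[k] ResidueTensor ε (B i →₀ R) :=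
    fun i => ResidueTensor.map ε (d i) with hD
  have hcyc : ∀ x, x ∈ cycles (k := k) (X := fun i => ResidueTensor ε (B i →₀ R)) D i := by
    intro x
    cases i with
    | zero => exact Submodule.mem_top
    | succ i =>
      change D i x = 0
      rw [hD]
      dsimp only
      rw [hzero, LinearMap.zero_apply]
  let q : ResidueTensor ε (B i →₀ R) →ₗ[k] Homology (k := k) (X := fun i => ResidueTensor ε (B i →₀ R)) D i :=
    (Submodule.mkQ _) ∘ₗ (LinearMap.id.codRestrict _ hcyc)
  have hq : Function.Injective q := by
    rw [injective_iff_map_eq_zero]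
    intro x hx
    obtain ⟨y, hy⟩ := (Submodule.Quotient.mk_eq_zero _).1 hx
    change D i y = x at hy
    rw [← hy, hD]
    dsimp only
    rw [hzero, LinearMap.zero_apply]
  let ψ : ({b : B i // deg i b = α} →₀ k) →ₗ[k] ResidueTensor ε (B i →₀ R) :=
    Finsupp.linearCombination k fun b => residueMk ε (Finsupp.single b.1 (1 : R))
  have hψ : Function.Injective ψ := by
    -- Reading off coordinates inverts `ψ` up to the inclusion of the index set, so the classes of
    -- basis elements stay independent.
    have h : residueCoord ε (B i) ∘ₗ ψ = Finsupp.lmapDomain k k Subtype.val := by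
      refine Finsupp.lhom_ext' fun b => LinearMap.ext_ring ?_
      ext c
      simp only [ψ, LinearMap.comp_apply, Finsupp.lsingle_apply, Finsupp.linearCombination_single,
        one_smul, residueCoord_mk, Finsupp.lmapDomain_apply, Finsupp.mapDomain_single]
      by_cases hc : b.1 = c
      · subst hc; simp
      · rw [Finsupp.single_eq_of_ne (Ne.symm hc), Finsupp.single_eq_of_ne (Ne.symm hc), map_zero]
    have h' : Function.Injective (residueCoord ε (B i) ∘ₗ ψ) := by
      rw [h]
      exact Finsupp.mapDomain_injective Subtype.val_injective
    rw [LinearMap.coe_comp] at h'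
    exact h'.of_comp
  have hrange : LinearMap.range (q ∘ₗ ψ) = homologyPiece (k := k) (X := fun i => ResidueTensor ε (B i →₀ R)) D
      (fun i α => ResidueTensor.piece ε (freePiece Rgr (deg i) α)) i α := by
    refine le_antisymm ?_ ?_
    · rw [LinearMap.range_comp, Finsupp.range_linearCombination, Submodule.map_span,
        Submodule.span_le]
      rintro _ ⟨_, ⟨⟨b, rfl⟩, rfl⟩, rfl⟩
      exact ⟨⟨_, hcyc _⟩, ⟨_, Submodule.subset_span ⟨b, 0, zero_add _, 1, h1, rfl⟩, rfl⟩, rfl⟩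
    · rintro _ ⟨⟨x, hx⟩, ⟨f, hf, rfl⟩, rfl⟩
      change q (residueMk ε f) ∈ _
      have hle : freePiece Rgr (deg i) α ≤
          (LinearMap.range (q ∘ₗ ψ)).comap (q ∘ₗ residueMk ε) := by
        refine Submodule.span_le.2 ?_
        rintro _ ⟨b, γ, hγ, r, hr, rfl⟩
        -- Only coefficients of multidegree `0` survive, and then the basis element itself has
        -- degree `α`.
        by_cases h0 : γ = 0
        · subst h0
          rw [zero_add] at hγ
          refine ⟨Finsupp.single ⟨b, hγ⟩ (ε r), ?_⟩
          simp only [ψ, LinearMap.comp_apply, Finsupp.linearCombination_single]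
          rw [residueMk_single ε b r]
        · rw [SetLike.mem_coe, Submodule.mem_comap, LinearMap.comp_apply, residueMk_single,
            hε γ h0 r hr, zero_smul, map_zero]
          exact Submodule.zero_mem _
      exact hle hf
  rw [← hrange, ← dimK_eq_of_equiv (LinearEquiv.ofInjective (q ∘ₗ ψ) (hq.comp hψ)), dimK,
    rank_finsupp_self, Cardinal.toENat_lift]
  rfl

end Minimal

/-! ### Exactness criteria -/

section Exactness

variable {k : Type*} [Field k] {R : Type*} [Ring R] [Algebra k R]

/-- A complex of free modules is exact in positive degrees if every basis element is active for
some index `m`, and for each `m` there is a homotopy `h m` such that `d h + h d` preserves the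
decomposition along the basis and is the identity on the active summands. -/
theorem exact_of_partial_homotopies {B : ℕ → Type*} {d : ∀ i, (B (i + 1) →₀ R) →ₗ[R] (B i →₀ R)}
    (hdd : ∀ i z, d i (d (i + 1) z) = 0) {M : Type*} [Finite M] (act : ∀ i, B i → M → Prop)
    (h : M → ∀ i, (B i →₀ R) →ₗ[k] (B (i + 1) →₀ R))
    (hh : ∀ m i c r, ∃ s, d (i + 1) (h m (i + 1) (Finsupp.single c r))
      + h m i (d i (Finsupp.single c r)) = Finsupp.single c s ∧ (act (i + 1) c m → s = r))
    (hact : ∀ i (c : B (i + 1)), ∃ m, act (i + 1) c m) (i : ℕ) :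
    Function.Exact (d (i + 1)) (d i) := by
  refine fun z => ⟨fun hz => ?_, ?_⟩
  swap
  · rintro ⟨y, rfl⟩
    exact hdd i y
  -- Indices are treated one at a time: after `T`, the remainder is supported on basis elements
  -- inactive for all of `T`. Once every index is treated, no support is left.
  have key : ∀ T : Set M, T.Finite →
      ∃ y, ∀ c, (z - d (i + 1) y) c ≠ 0 → ∀ m ∈ T, ¬ act (i + 1) c m := by
    intro T hT
    induction T, hT using Set.Finite.induction_on with
    | empty => exact ⟨0, fun _ _ m hm => absurd hm (Set.notMem_empty m)⟩
    | @insert m T _ _ ih =>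
      obtain ⟨y, hy⟩ := ih
      set z' := z - d (i + 1) y with hz'
      have hdz : d i z' = 0 := by rw [hz', map_sub, hz, hdd, sub_zero]
      refine ⟨y + h m (i + 1) z', fun c hc => ?_⟩
      -- Since `d h + h d` preserves the summands, its coordinate at `c` depends only on the
      -- coordinate of `u` at `c`.
      have hK : ∀ u : B (i + 1) →₀ R, (d (i + 1) (h m (i + 1) u) + h m i (d i u)) c
          = (d (i + 1) (h m (i + 1) (Finsupp.single c (u c)))
            + h m i (d i (Finsupp.single c (u c)))) c := by
        intro u
        induction u using Finsupp.induction_linear with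
        | zero => simp
        | add u v hu hv =>
          simp only [map_add, Finsupp.add_apply, Finsupp.single_add] at hu hv ⊢
          rw [add_add_add_comm, hu, hv, add_add_add_comm]
        | single c' r =>
          by_cases hcc : c' = c
          · subst hcc; simp
          · obtain ⟨s, hs, -⟩ := hh m i c' r
            rw [hs, Finsupp.single_eq_of_ne (Ne.symm hcc), Finsupp.single_eq_of_ne (Ne.symm hcc)]
            simp
      have hKz := hK z'
      rw [hdz, map_zero, add_zero] at hKz
      obtain ⟨s, hs, hsact⟩ := hh m i c (z' c)
      rw [hs, Finsupp.single_eq_same] at hKz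
      have hc' : z' c - s ≠ 0 := by
        rwa [map_add, ← sub_sub, ← hz', Finsupp.sub_apply, hKz] at hc
      have hm : ¬ act (i + 1) c m := fun ha => hc' (by rw [hsact ha, sub_self])
      -- The correction for `m` creates no new support, so what was achieved for earlier indices
      -- persists.
      have hzc : z' c ≠ 0 := by
        intro h0
        rw [h0, Finsupp.single_zero, map_zero, map_zero, map_zero, map_zero, add_zero] at hs
        have hs0 := Finsupp.single_eq_zero.1 hs.symm
        exact hc' (by rw [h0, hs0, sub_zero])
      rintro m' (rfl | hm')
      · exact hm
      · exact hy c hzc m' hm'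
  obtain ⟨y, hy⟩ := key Set.univ Set.finite_univ
  refine ⟨y, (sub_eq_zero.1 (Finsupp.ext fun c => ?_)).symm⟩
  by_contra hc
  obtain ⟨m, hm⟩ := hact i c
  exact hy c hc m (Set.mem_univ m) hm

/-! ### The kernel of multiplication -/

variable {A : Type*} [Ring A] [Algebra k A] {σ : Type*} {x : σ → A}

/-- Modulo the elements `x s ⊗ 1 - 1 ⊗ x s`, every element of `A ⊗ Aᵒᵖ` comes from `Aᵒᵖ`. -/
theorem env_sub_mem (hA : ⨆ α, algPiece (k := k) x α = ⊤) {I : Submodule (Env k A) (Env k A)}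
    (hI : ∀ s, x s ⊗ₜ[k] 1 - 1 ⊗ₜ[k] MulOpposite.op (x s) ∈ I) (r : Env k A) :
    r - 1 ⊗ₜ[k] MulOpposite.op (r • (1 : A)) ∈ I := by
  -- Letters cross the tensor sign one at a time, starting from the right end of the word: `w x_s ⊗
  -- b - w ⊗ x_s b` is `w ⊗ b` times an element of `I`.
  have hw : ∀ (l : List σ) (b : A), (l.map x).prod ⊗ₜ[k] MulOpposite.op b
      - 1 ⊗ₜ[k] MulOpposite.op ((l.map x).prod * b) ∈ I := by
    intro l
    induction l using List.reverseRecOn with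
    | nil => simp
    | append_singleton l s ih =>
      intro b
      have h1 := I.smul_mem ((l.map x).prod ⊗ₜ[k] MulOpposite.op b : Env k A) (hI s)
      have h2 := I.add_mem h1 (ih (x s * b))
      convert h2 using 1
      simp [mul_sub, mul_assoc]
  have ht : ∀ a b : A, a ⊗ₜ[k] MulOpposite.op b - 1 ⊗ₜ[k] MulOpposite.op (a * b) ∈ I := by
    intro a b
    let f : A →ₗ[k] Env k A :=
      (TensorProduct.mk k A Aᵐᵒᵖ).flip (MulOpposite.op b)
        - (TensorProduct.mk k A Aᵐᵒᵖ 1) ∘ₗ (MulOpposite.opLinearEquiv k).toLinearMap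
          ∘ₗ LinearMap.mulRight k b
    have hf : ⨆ α, algPiece (k := k) x α ≤ (I.restrictScalars k).comap f := by
      refine iSup_le fun α => Submodule.span_le.2 ?_
      rintro _ ⟨l, -, rfl⟩
      exact hw l b
    rw [hA] at hf
    exact hf (Submodule.mem_top (x := a))
  induction r using TensorProduct.induction_on with
  | zero =>
    rw [zero_smul (Env k A) (1 : A)]
    simp
  | tmul a b =>
    rw [env_tmul_smul, mul_one]
    exact ht a b.unop
  | add r s hr hs =>
    rw [add_smul (r : Env k A) s (1 : A), MulOpposite.op_add, TensorProduct.tmul_add,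
      add_sub_add_comm]
    exact I.add_mem hr hs

/-- Exactness at the end of a complex resolving `A` over `A ⊗ Aᵒᵖ`. -/
theorem exact_augmentation (hA : ⨆ α, algPiece (k := k) x α = ⊤) {B₀ B₁ : Type*} [Unique B₀]
    {d : (B₁ →₀ Env k A) →ₗ[Env k A] (B₀ →₀ Env k A)}
    (haug : ∀ b, Finsupp.linearCombination (Env k A) (fun _ => (1 : A)) (d (Finsupp.single b 1)) = 0)
    (hx : ∀ s, ∃ y, d y = Finsupp.single default
      (x s ⊗ₜ[k] 1 - 1 ⊗ₜ[k] MulOpposite.op (x s) : Env k A)) :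
    Function.Exact d (Finsupp.linearCombination (Env k A) fun _ => (1 : A)) := by
  refine fun z => ⟨fun hz => ?_, ?_⟩
  -- There is a single basis element; `I` consists of the coefficients whose multiple of it is a
  -- boundary.
  · have h := env_sub_mem hA (I := (LinearMap.range d).comap (Finsupp.lsingle default)) hx
      (z default)
    have hz' : (z default) • (1 : A) = 0 := by
      rw [Finsupp.unique_single z, Finsupp.linearCombination_single] at hz
      exact hz
    rw [hz', MulOpposite.op_zero, TensorProduct.tmul_zero, sub_zero] at h
    rw [Finsupp.unique_single z]
    exact h
  · rintro ⟨y, rfl⟩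
    have h : Finsupp.linearCombination (Env k A) (fun _ => (1 : A)) ∘ₗ d = 0 := by
      refine Finsupp.lhom_ext' fun b => LinearMap.ext_ring ?_
      exact haug b
    exact LinearMap.congr_fun h y

end Exactness

/-! ### Augmentations of graded algebras -/

section Augmentation

variable {k : Type*} [Field k] {A : Type*} [Ring A] [Algebra k A] {σ : Type*} {x : σ → A}
  {ε : A →ₐ[k] k}

/-- A word of nonzero degree is nonempty, and `ε` kills its first letter. -/
theorem aug_eq_zero_of_mem_algPiece (hε : ∀ s, ε (x s) = 0) {γ : σ →₀ ℕ} (hγ : γ ≠ 0) {a : A}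
    (ha : a ∈ algPiece (k := k) x γ) : ε a = 0 := by
  have h : algPiece (k := k) x γ ≤ LinearMap.ker ε.toLinearMap := by
    refine Submodule.span_le.2 ?_
    rintro _ ⟨l, hl, rfl⟩
    cases l with
    | nil => exact absurd hl.symm hγ
    | cons s l => simp [hε]
  exact h ha

theorem envAug_tmul (a b : A) : envAug ε (a ⊗ₜ[k] MulOpposite.op b) = ε a * ε b := by
  simp [envAug]

theorem envAug_eq_zero_of_mem_envPiece (hε : ∀ s, ε (x s) = 0) (γ : σ →₀ ℕ) (hγ : γ ≠ 0)
    (r : Env k A) (hr : r ∈ envPiece (k := k) x γ) : envAug ε r = 0 := by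
  have h : envPiece (k := k) x γ ≤ LinearMap.ker (envAug ε).toLinearMap := by
    refine Submodule.span_le.2 ?_
    rintro _ ⟨α, β, rfl, a, ha, b, hb, rfl⟩
    rw [SetLike.mem_coe, LinearMap.mem_ker, AlgHom.toLinearMap_apply, envAug_tmul]
    by_cases h : α = 0
    · have h' : β ≠ 0 := fun h' => hγ (by rw [h, h', add_zero])
      rw [aug_eq_zero_of_mem_algPiece hε h' hb, mul_zero]
    · rw [aug_eq_zero_of_mem_algPiece hε h ha, zero_mul]
  exact h hr

theorem isMinimal_of_single {R : Type*} [Ring R] [Algebra k R] {ε : R →ₐ[k] k} {B : ℕ → Type*}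
    {d : ∀ i, (B (i + 1) →₀ R) →ₗ[R] (B i →₀ R)}
    (h : ∀ i c b, ε (d i (Finsupp.single c 1) b) = 0) : IsMinimal ε d := by
  intro i y b
  induction y using Finsupp.induction_linear with
  | zero => simp
  | add y z hy hz => rw [map_add, Finsupp.add_apply, map_add, hy, hz, add_zero]
  | single c r =>
    rw [← mul_one r, ← smul_eq_mul, ← Finsupp.smul_single, map_smul, Finsupp.smul_apply,
      smul_eq_mul, map_mul, h, mul_zero]

theorem hilbTor_envPiece_of_isMinimal (hε : ∀ s, ε (x s) = 0) {B : ℕ → Type*}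
    {deg : ∀ i, B i → σ →₀ ℕ} {d : ∀ i, (B (i + 1) →₀ Env k A) →ₗ[Env k A] (B i →₀ Env k A)}
    (hd : IsMinimal (envAug ε) d) (m : Option σ →₀ ℕ) :
    hilbTor (envAug ε) (envPiece (k := k) x) deg d m
      = ENat.card {b : B (m none) // deg _ b = m.some} :=
  hilbTor_of_isMinimal (Rgr := envPiece (k := k) x) one_mem_envPiece
    (fun γ hγ r hr => envAug_eq_zero_of_mem_envPiece hε γ hγ r hr) hd m

/-- A double sum of an alternating family vanishes. -/
theorem sum_sum_eq_zero_of_alternating {ι M : Type*} [Fintype ι] [DecidableEq ι] [AddCommGroup M]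
    {t : ι → ι → M} (h0 : ∀ i, t i i = 0) (h : ∀ i j, i ≠ j → t i j + t j i = 0) :
    ∑ i, ∑ j, t i j = 0 := by
  rw [← Fintype.sum_prod_type' (f := t)]
  refine Finset.sum_involution (fun p _ => p.swap) (fun p _ => ?_) (fun p _ hp hs => ?_)
    (fun _ _ => Finset.mem_univ _) (fun p _ => p.swap_swap)
  · by_cases hp : p.1 = p.2
    · rcases p with ⟨i, j⟩
      obtain rfl : i = j := hp
      simp [h0]
    · exact h _ _ hp
  · rcases p with ⟨i, j⟩
    obtain rfl : j = i := congrArg Prod.fst hs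
    exact hp (h0 _)

end Augmentation

/-! ### The exterior algebra -/

section Exterior

variable {k : Type*} [Field k] {n : ℕ}

theorem ExtAlg.x_mul_self (j : Fin n) : ExtAlg.x k n j * ExtAlg.x k n j = 0 :=
  ExteriorAlgebra.ι_sq_zero _

theorem ExtAlg.x_mul_x (i j : Fin n) :
    ExtAlg.x k n i * ExtAlg.x k n j = -(ExtAlg.x k n j * ExtAlg.x k n i) :=
  eq_neg_of_add_eq_zero_left (ExteriorAlgebra.ι_add_mul_swap _ _)

theorem ExtAlg.aug_x (j : Fin n) : ExtAlg.aug k n (ExtAlg.x k n j) = 0 := by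
  simp [ExtAlg.aug, ExtAlg.x, ExteriorAlgebra.algebraMapInv]

variable (k n) in
/-- The basis of monomials of the exterior algebra. -/
def ExtAlg.basis : Module.Basis (Finset (Fin n)) k (ExtAlg k n) :=
  (Pi.basisFun k (Fin n)).ExteriorAlgebra

theorem ExtAlg.basis_empty : ExtAlg.basis k n ∅ = 1 := by
  rw [ExtAlg.basis, ExteriorAlgebra.basis_apply_ofCard _ (n := 0) Finset.card_empty]
  simp [ExteriorAlgebra.ιMulti_family]

theorem ExtAlg.basis_singleton (j : Fin n) : ExtAlg.basis k n {j} = ExtAlg.x k n j := by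
  rw [ExtAlg.basis, ExteriorAlgebra.basis_apply_ofCard _ (n := 1) (Finset.card_singleton j)]
  have h : ∀ l, Set.powersetCard.ofFinEmbEquiv.symm
      (Set.powersetCard.ofCard (Finset.card_singleton j)) l = j := fun l =>
    Finset.mem_singleton.1 ((Set.powersetCard.mem_range_ofFinEmbEquiv_symm_iff_mem
      (Set.powersetCard.ofCard (Finset.card_singleton j)) _).1 ⟨l, rfl⟩)
  rw [ExteriorAlgebra.ιMulti_family, ExteriorAlgebra.ιMulti_apply]
  simp [h, ExtAlg.x]

theorem ExtAlg.x_mul_basis_of_mem {j : Fin n} {s : Finset (Fin n)} (h : j ∈ s) :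
    ExtAlg.x k n j * ExtAlg.basis k n s = 0 := by
  rw [← ExtAlg.basis_singleton]
  exact ExteriorAlgebra.basis_mul_of_not_disjoint _ ⟨{j}, Finset.card_singleton j⟩ ⟨s, rfl⟩
    (by simpa using h)

theorem ExtAlg.x_mul_basis_of_notMem {j : Fin n} {s : Finset (Fin n)} (h : j ∉ s) :
    ∃ u : ℤˣ, ExtAlg.x k n j * ExtAlg.basis k n s = u • ExtAlg.basis k n (insert j s) := by
  have hd : Disjoint ({j} : Finset (Fin n)) s := by simpa using h
  have h := ExteriorAlgebra.basis_mul_of_disjoint (Pi.basisFun k (Fin n))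
    ⟨{j}, Finset.card_singleton j⟩ ⟨s, rfl⟩ hd
  have hi : insert j s = (Set.powersetCard.disjUnion (s := ⟨{j}, Finset.card_singleton j⟩)
      (t := ⟨s, rfl⟩) hd).val := by
    ext
    simp
  rw [← ExtAlg.basis_singleton, hi]
  exact ⟨_, h⟩

/-- The multidegree of a squarefree monomial. -/
def finsetDeg (s : Finset (Fin n)) : Fin n →₀ ℕ := ∑ j ∈ s, Finsupp.single j 1

theorem finsetDeg_insert {j : Fin n} {s : Finset (Fin n)} (h : j ∉ s) :
    finsetDeg (insert j s) = Finsupp.single j 1 + finsetDeg s :=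
  Finset.sum_insert h

theorem finsetDeg_degree (s : Finset (Fin n)) : (finsetDeg s).degree = s.card := by
  simp [finsetDeg, map_sum]

theorem ExtAlg.basis_mem_algPiece (s : Finset (Fin n)) :
    ExtAlg.basis k n s ∈ algPiece (k := k) (ExtAlg.x k n) (finsetDeg s) := by
  induction s using Finset.induction_on with
  | empty =>
    rw [ExtAlg.basis_empty]
    exact one_mem_algPiece
  | insert j s hj ih =>
    obtain ⟨u, hu⟩ := ExtAlg.x_mul_basis_of_notMem (k := k) hj
    have h := mul_mem_algPiece (generator_mem_algPiece (k := k) (x := ExtAlg.x k n) j) ih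
    rw [hu, ← finsetDeg_insert hj] at h
    rcases Int.units_eq_one_or u with rfl | rfl
    · simpa using h
    · simpa using h

/-- Left multiplication by `x_j` sends a basis monomial to zero or, up to sign, to a basis monomial
of degree larger by the `j`-th unit vector. So a word lies in the span of the monomials of its own
degree. -/
theorem ExtAlg.isHomogeneousBasis_basis :
    IsHomogeneousBasis (algPiece (k := k) (ExtAlg.x k n)) (ExtAlg.basis k n) finsetDeg := by
  intro α
  refine le_antisymm (Submodule.span_le.2 ?_) (Submodule.span_le.2 ?_)
  · rintro _ ⟨l, rfl, rfl⟩
    induction l with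
    | nil => exact Submodule.subset_span ⟨∅, rfl, by simp [ExtAlg.basis_empty]⟩
    | cons j l ih =>
      rw [List.map_cons (f := ExtAlg.x k n), List.prod_cons, List.map_cons, List.sum_cons]
      generalize (l.map fun s => Finsupp.single s 1).sum = β at ih ⊢
      have h : Submodule.span k (ExtAlg.basis k n '' {s | finsetDeg s = β}) ≤
          (Submodule.span k (ExtAlg.basis k n '' {s | finsetDeg s = Finsupp.single j 1 + β})).comap
            (LinearMap.mulLeft k (ExtAlg.x k n j)) := by
        refine Submodule.span_le.2 ?_
        rintro _ ⟨s, rfl, rfl⟩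
        rw [SetLike.mem_coe, Submodule.mem_comap, LinearMap.mulLeft_apply]
        by_cases hj : j ∈ s
        · rw [ExtAlg.x_mul_basis_of_mem hj]
          exact Submodule.zero_mem _
        · obtain ⟨u, hu⟩ := ExtAlg.x_mul_basis_of_notMem (k := k) hj
          have h1 : ExtAlg.basis k n (insert j s) ∈ Submodule.span k
              (ExtAlg.basis k n '' {t | finsetDeg t = Finsupp.single j 1 + finsetDeg s}) :=
            Submodule.subset_span ⟨_, finsetDeg_insert hj, rfl⟩
          rw [hu]
          rcases Int.units_eq_one_or u with rfl | rfl
          · simpa using h1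
          · simpa using h1
      exact h ih
  · rintro _ ⟨s, rfl, rfl⟩
    exact ExtAlg.basis_mem_algPiece s

/-- Contraction with the `m`-th coordinate on the right of the first factor of `E ⊗ Eᵒᵖ`. -/
def ExtAlg.contract (m : Fin n) : Env k (ExtAlg k n) →ₗ[k] Env k (ExtAlg k n) :=
  TensorProduct.map
    ((CliffordAlgebra.contractRight (R := k) (M := Fin n → k) (Q := 0)).flip (LinearMap.proj m))
    LinearMap.id

variable (k) in
/-- The element `x_j ⊗ 1 + s (1 ⊗ x_j)`. -/
def cartanCoeff (s : k) (j : Fin n) : Env k (ExtAlg k n) :=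
  ExtAlg.x k n j ⊗ₜ[k] 1 + s • 1 ⊗ₜ[k] MulOpposite.op (ExtAlg.x k n j)

/-- In the unsigned product `x_j ⊗ 1` and `1 ⊗ x_j` commute and have square zero; the opposite signs
make the mixed terms cancel. This is why the sign in the differential alternates with the degree. -/
theorem cartanCoeff_mul_self (s : k) (j : Fin n) :
    cartanCoeff k s j * cartanCoeff k (-s) j = 0 := by
  simp only [cartanCoeff, mul_add, add_mul, Algebra.TensorProduct.tmul_mul_tmul, one_mul, mul_one,
    TensorProduct.smul_tmul', neg_smul, mul_neg,
    ExtAlg.x_mul_self, smul_mul_assoc, mul_smul_comm, ← MulOpposite.op_mul, MulOpposite.op_zero,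
    TensorProduct.tmul_zero, TensorProduct.zero_tmul]
  rw [TensorProduct.neg_tmul]
  abel

/-- The terms living in one tensor factor cancel by anticommutativity, the mixed ones because `s`
and `-s` are opposite. -/
theorem cartanCoeff_mul_comm (s : k) (i j : Fin n) :
    cartanCoeff k s i * cartanCoeff k (-s) j + cartanCoeff k s j * cartanCoeff k (-s) i = 0 := by
  simp only [cartanCoeff, mul_add, add_mul, Algebra.TensorProduct.tmul_mul_tmul, one_mul, mul_one,
    TensorProduct.smul_tmul', neg_smul, mul_neg,
    smul_mul_assoc, mul_smul_comm, ← MulOpposite.op_mul]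
  rw [ExtAlg.x_mul_x i j, MulOpposite.op_neg]
  simp only [TensorProduct.tmul_neg, TensorProduct.neg_tmul]
  abel

/-- Right contraction is an antiderivation: contracting `a x_j` gives `δ_{jm} a - (a ⌊ m) x_j`. The
second tensor factor is untouched by it, and there the signs `s` and `-s` of consecutive degrees
cancel. -/
theorem ExtAlg.contract_mul_coeff (s : k) (m j : Fin n) (r : Env k (ExtAlg k n)) :
    ExtAlg.contract m r * cartanCoeff k (-s) j + ExtAlg.contract m (r * cartanCoeff k s j)
      = if j = m then r else 0 := by
  induction r using TensorProduct.induction_on with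
  | zero => simp
  | add r r' hr hr' =>
    have h : (if j = m then r + r' else 0) = (if j = m then r else 0) + if j = m then r' else 0 := by
      split_ifs <;> simp
    rw [h, ← hr, ← hr', map_add, add_mul, add_mul, map_add]
    abel
  | tmul a b =>
    have h := CliffordAlgebra.contractRight_mul_ι (Q := (0 : QuadraticForm k (Fin n → k)))
      (LinearMap.proj m) (Pi.single j (1 : k)) a
    have h' : ((CliffordAlgebra.contractRight (R := k) (M := Fin n → k) (Q := 0)).flip
      (LinearMap.proj m)) (a * ExtAlg.x k n j) = (if j = m then a else 0)
        - ((CliffordAlgebra.contractRight (R := k) (M := Fin n → k) (Q := 0)).flip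
      (LinearMap.proj m)) a * ExtAlg.x k n j := by
      rw [LinearMap.flip_apply, LinearMap.flip_apply]
      refine h.trans ?_
      congr 1
      by_cases hjm : j = m
      · subst hjm; simp
      · simp [hjm, Ne.symm hjm]
    simp only [cartanCoeff, mul_add, Algebra.TensorProduct.tmul_mul_tmul, mul_one,
      TensorProduct.smul_tmul', neg_smul, mul_neg,
      mul_smul_comm, map_add, map_smul, ExtAlg.contract, TensorProduct.map_tmul, h',
      LinearMap.id_apply, TensorProduct.sub_tmul]
    rw [TensorProduct.neg_tmul]
    split_ifs
    · abel
    · rw [TensorProduct.zero_tmul]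
      abel

end Exterior

/-! ### The divided power complex -/

theorem linearCombination_sum_single {R B C ι : Type*} [Ring R] [Fintype ι] (f : B → ι → C →₀ R)
    (b : B) (r : R) : Finsupp.linearCombination R (fun b => ∑ j, f b j) (Finsupp.single b r)
      = ∑ j, r • f b j := by
  rw [Finsupp.linearCombination_single, Finset.smul_sum]

theorem smul_dite_single {R C : Type*} [Ring R] {p : Prop} [Decidable p] (c : p → C) (r s : R) :
    r • (if h : p then Finsupp.single (c h) s else 0)
      = if h : p then Finsupp.single (c h) (r * s) else 0 := by
  split_ifs <;> simp

section CartanResolution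

variable {k : Type*} [Field k] {n : ℕ}

variable (k) in
/-- The multiples of the symbol `e^{(l)}` in homological degree `i`; zero if the degree of `l` is
not `i`. -/
def cartanMono (i : ℕ) (l : Fin n →₀ ℕ) :
    Env k (ExtAlg k n) →ₗ[Env k (ExtAlg k n)] (CartanBasis n i →₀ Env k (ExtAlg k n)) :=
  if h : l.degree = i then Finsupp.lsingle ⟨l, h⟩ else 0

theorem cartanMono_of_eq {i : ℕ} (l : CartanBasis n i) (r : Env k (ExtAlg k n)) :
    cartanMono k i l.1 r = Finsupp.single l r := by
  rw [cartanMono, dif_pos l.2]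
  rfl

theorem cartanMono_of_ne {i : ℕ} {l : Fin n →₀ ℕ} (h : l.degree ≠ i) (r : Env k (ExtAlg k n)) :
    cartanMono k i l r = 0 := by
  rw [cartanMono, dif_neg h]
  rfl

theorem degree_sub_single {l : Fin n →₀ ℕ} {j : Fin n} (h : l j ≠ 0) :
    (l - Finsupp.single j 1).degree + 1 = l.degree := by
  have h1 : Finsupp.single j 1 ≤ l := by
    rw [Finsupp.single_le_iff]; omega
  have h2 := congrArg Finsupp.degree (tsub_add_cancel_of_le h1)
  rwa [map_add, Finsupp.degree_single] at h2

/-- Indexing by all `l`, with value `0` in the wrong degree, frees later computations from degree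
proofs. Off degree `i + 1` both sides vanish, since lowering a nonzero entry drops the degree by
exactly one. -/
theorem cartanD_mono (i : ℕ) (l : Fin n →₀ ℕ) (r : Env k (ExtAlg k n)) :
    cartanD k n i (cartanMono k (i + 1) l r) = ∑ j, if l j ≠ 0 then
      cartanMono k i (l - Finsupp.single j 1) (r * cartanCoeff k ((-1) ^ (i + 1)) j) else 0 := by
  by_cases hl : l.degree = i + 1
  · rw [cartanMono_of_eq ⟨l, hl⟩]
    refine (linearCombination_sum_single _ _ _).trans (Finset.sum_congr rfl fun j _ =>
      (smul_dite_single _ _ _).trans ?_)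
    by_cases h : l j ≠ 0
    · rw [dif_pos h, if_pos h]
      exact (cartanMono_of_eq (CartanBasis.lower ⟨l, hl⟩ j h) _).symm
    · rw [dif_neg h, if_neg h]
  · rw [cartanMono_of_ne hl, map_zero]
    refine (Finset.sum_eq_zero fun j _ => ?_).symm
    split_ifs with h
    · refine cartanMono_of_ne (fun h' => hl ?_) _
      rw [← degree_sub_single h, h']
    · rfl

/-- Lowering at `j` then `j'` reaches the same symbol as in the other order, and consecutive
differentials carry opposite signs, so the double sum is alternating. -/
theorem cartanD_cartanD (i : ℕ) (z : CartanBasis n (i + 2) →₀ Env k (ExtAlg k n)) :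
    cartanD k n i (cartanD k n (i + 1) z) = 0 := by
  induction z using Finsupp.induction_linear with
  | zero => simp
  | add y z hy hz => rw [map_add, map_add, hy, hz, add_zero]
  | single l r =>
    have hs : (-1 : k) ^ (i + 1) = -(-1) ^ (i + 1 + 1) := by rw [pow_succ _ (i + 1)]; simp
    have h1 : ∀ j, cartanD k n i (if l.1 j ≠ 0 then cartanMono k (i + 1) (l.1 - Finsupp.single j 1)
        (r * cartanCoeff k ((-1) ^ (i + 1 + 1)) j) else 0) = ∑ j', if l.1 j ≠ 0 ∧
          (l.1 - Finsupp.single j 1 : Fin n →₀ ℕ) j' ≠ 0 then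
          cartanMono k i (l.1 - Finsupp.single j 1 - Finsupp.single j' 1)
            (r * (cartanCoeff k ((-1) ^ (i + 1 + 1)) j * cartanCoeff k (-(-1) ^ (i + 1 + 1)) j'))
          else 0 := by
      intro j
      by_cases h : l.1 j ≠ 0
      · rw [if_pos h, cartanD_mono, hs]
        refine Finset.sum_congr rfl fun j' _ => ?_
        simp only [h, ne_eq, not_false_eq_true, true_and, mul_assoc]
      · simp [h]
    rw [← cartanMono_of_eq, cartanD_mono, map_sum, Finset.sum_congr rfl fun j _ => h1 j]
    refine sum_sum_eq_zero_of_alternating (M := CartanBasis n i →₀ Env k (ExtAlg k n))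
      (fun j => ?_) fun j j' hj => ?_
    · rw [cartanCoeff_mul_self]
      simp
    · have h2 : (l.1 - Finsupp.single j 1 : Fin n →₀ ℕ) j' = l.1 j' := by
        simp [hj]
      have h3 : (l.1 - Finsupp.single j' 1 : Fin n →₀ ℕ) j = l.1 j := by
        simp [hj.symm]
      rw [h2, h3, tsub_right_comm]
      by_cases h : l.1 j ≠ 0 ∧ l.1 j' ≠ 0
      · rw [if_pos h, if_pos h.symm, ← map_add, ← mul_add, cartanCoeff_mul_comm, mul_zero, map_zero]
      · rw [if_neg h, if_neg fun h' => h h'.symm, add_zero]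

variable (k) in
/-- The homotopy `r e^{(l)} ↦ (r ⌊ m) e_m e^{(l)}`. -/
def cartanHomotopy (m : Fin n) (i : ℕ) : (CartanBasis n i →₀ Env k (ExtAlg k n)) →ₗ[k]
    (CartanBasis n (i + 1) →₀ Env k (ExtAlg k n)) :=
  Finsupp.lsum k fun l =>
    (cartanMono k (i + 1) (l.1 + Finsupp.single m 1)).restrictScalars k ∘ₗ ExtAlg.contract m

theorem cartanHomotopy_mono (m : Fin n) (i : ℕ) (l : Fin n →₀ ℕ) (r : Env k (ExtAlg k n)) :
    cartanHomotopy k m i (cartanMono k i l r)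
      = cartanMono k (i + 1) (l + Finsupp.single m 1) (ExtAlg.contract m r) := by
  by_cases hl : l.degree = i
  · rw [cartanMono_of_eq ⟨l, hl⟩, cartanHomotopy, Finsupp.lsum_single]
    rfl
  · rw [cartanMono_of_ne hl, map_zero, cartanMono_of_ne]
    rw [map_add, Finsupp.degree_single]
    omega

/-- Lowering at `j ≠ m` commutes with raising at `m`, so these terms of `d h` and `h d` cancel. The
terms of index `m` return to the symbol `l`. -/
theorem cartanD_homotopy (m : Fin n) (i : ℕ) (l : CartanBasis n (i + 1))
    (r : Env k (ExtAlg k n)) :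
    ∃ s, cartanD k n (i + 1) (cartanHomotopy k m (i + 1) (Finsupp.single l r))
      + cartanHomotopy k m i (cartanD k n i (Finsupp.single l r)) = Finsupp.single l s
        ∧ (l.1 m ≠ 0 → s = r) := by
  have hs : (-1 : k) ^ (i + 1 + 1) = -(-1) ^ (i + 1) := by rw [pow_succ _ (i + 1)]; simp
  -- If `l m = 0`, then `h d` has no term of index `m` and that of `d h` remains alone; only its
  -- staying in the summand of `l` matters.
  refine ⟨if l.1 m ≠ 0 then r else
    ExtAlg.contract m r * cartanCoeff k (-(-1) ^ (i + 1)) m, ?_, fun h => if_pos h⟩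
  rw [← cartanMono_of_eq l r, cartanHomotopy_mono, cartanD_mono, cartanD_mono, map_sum,
    ← Finset.sum_add_distrib, Finset.sum_eq_single m, hs]
  · rw [if_pos (by simp), add_tsub_cancel_right]
    by_cases h : l.1 m ≠ 0
    · have h1 : Finsupp.single m 1 ≤ l.1 := by
        rw [Finsupp.single_le_iff]; omega
      rw [if_pos h, if_pos h, cartanHomotopy_mono, tsub_add_cancel_of_le h1, ← map_add,
        ExtAlg.contract_mul_coeff, if_pos rfl, cartanMono_of_eq]
    · rw [if_neg h, if_neg h, map_zero, add_zero, cartanMono_of_eq]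
  · intro j _ hj
    have h1 : (l.1 + Finsupp.single m 1 : Fin n →₀ ℕ) j = l.1 j := by simp [hj]
    rw [h1]
    by_cases h : l.1 j ≠ 0
    · have h2 : Finsupp.single j 1 ≤ l.1 := by
        rw [Finsupp.single_le_iff]; omega
      rw [if_pos h, if_pos h, cartanHomotopy_mono, ← tsub_add_eq_add_tsub h2, ← map_add, hs,
        ExtAlg.contract_mul_coeff, if_neg hj, map_zero]
    · rw [if_neg h, if_neg h, map_zero, add_zero]
  · exact fun h => absurd (Finset.mem_univ m) h

theorem cartanD_exact (i : ℕ) : Function.Exact (cartanD k n (i + 1)) (cartanD k n i) := by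
  refine exact_of_partial_homotopies cartanD_cartanD (fun _ l m => l.1 m ≠ 0) (cartanHomotopy k)
    cartanD_homotopy (fun i l => ?_) i
  by_contra! h
  have h0 : l.1 = 0 := Finsupp.ext h
  have := l.2
  rw [h0, map_zero] at this
  omega

instance : Unique (CartanBasis n 0) where
  default := ⟨0, map_zero _⟩
  uniq l := Subtype.ext ((Finsupp.degree_eq_zero_iff _).1 l.2)

theorem cartanCoeff_neg_one (j : Fin n) : cartanCoeff k (-1) j
    = ExtAlg.x k n j ⊗ₜ[k] 1 - 1 ⊗ₜ[k] MulOpposite.op (ExtAlg.x k n j) := by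
  rw [cartanCoeff, TensorProduct.smul_tmul', neg_smul, one_smul, TensorProduct.neg_tmul,
    sub_eq_add_neg]

/-- The lowest differential has sign `-1`, so `e_j` maps to `x_j ⊗ 1 - 1 ⊗ x_j`, as
`exact_augmentation` requires. -/
theorem cartanAug_exact : Function.Exact (cartanD k n 0) (cartanAug k n) := by
  refine exact_augmentation (x := ExtAlg.x k n) ExtAlg.isHomogeneousBasis_basis.iSup_eq_top
    (fun l => ?_) fun j => ⟨Finsupp.single ⟨Finsupp.single j 1, Finsupp.degree_single _ _⟩ 1, ?_⟩
  · rw [← cartanMono_of_eq, cartanD_mono, map_sum]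
    refine Finset.sum_eq_zero fun j _ => ?_
    split_ifs with h
    · have hd : (l.1 - Finsupp.single j 1).degree = 0 := by
        have := degree_sub_single h
        have := l.2
        omega
      rw [cartanMono_of_eq ⟨_, hd⟩, Finsupp.linearCombination_single, zero_add, pow_one, one_mul,
        cartanCoeff_neg_one,
        sub_smul (ExtAlg.x k n j ⊗ₜ[k] 1 : Env k (ExtAlg k n)) (1 ⊗ₜ[k] MulOpposite.op (ExtAlg.x k n j))
          (1 : ExtAlg k n), env_tmul_smul, env_tmul_smul]
      simp
    · rw [map_zero]
  · rw [← cartanMono_of_eq, cartanD_mono, Finset.sum_eq_single j]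
    · have h : (-1 : k) ^ (0 + 1) = -1 := by simp
      rw [if_pos (by simp), h, one_mul, cartanCoeff_neg_one, tsub_self]
      exact cartanMono_of_eq (default : CartanBasis n 0) _
    · intro j' _ hj
      rw [if_neg (by simp [hj])]
    · exact fun h => absurd (Finset.mem_univ j) h

theorem cartanCoeff_mem_envPiece (s : k) (j : Fin n) :
    cartanCoeff k s j ∈ envPiece (k := k) (ExtAlg.x k n) (Finsupp.single j 1) := by
  have h1 := tmul_mem_envPiece (generator_mem_algPiece (k := k) (x := ExtAlg.x k n) j)
    one_mem_algPiece
  have h2 := tmul_mem_envPiece (one_mem_algPiece (k := k) (x := ExtAlg.x k n))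
    (generator_mem_algPiece j)
  rw [add_zero] at h1
  rw [zero_add] at h2
  exact Submodule.add_mem _ h1 (Submodule.smul_mem _ s h2)

theorem cartan_isMultigradedFreeResolution :
    IsMultigradedFreeResolution (N := ExtAlg k n) (envPiece (ExtAlg.x k n))
      (algPiece (ExtAlg.x k n)) (B := CartanBasis n) (fun _ l => l.1) (cartanD k n)
      (cartanAug k n) where
  aug_surjective a := ⟨Finsupp.single default (a ⊗ₜ[k] 1), by
    rw [cartanAug, Finsupp.linearCombination_single, env_tmul_smul]
    simp⟩
  exact_zero := cartanAug_exact
  exact_succ := cartanD_exact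
  aug_homogeneous l := by
    rw [cartanAug, Finsupp.linearCombination_single, one_smul, (Finsupp.degree_eq_zero_iff _).1 l.2]
    exact one_mem_algPiece
  d_homogeneous i l := by
    rw [← cartanMono_of_eq, cartanD_mono]
    refine Submodule.sum_mem _ fun j _ => ?_
    split_ifs with h
    · have h1 : Finsupp.single j 1 ≤ l.1 := by
        rw [Finsupp.single_le_iff]; omega
      refine Submodule.subset_span ⟨l.lower j h, Finsupp.single j 1, add_tsub_cancel_of_le h1,
        _, ?_, cartanMono_of_eq (l.lower j h) _⟩
      rw [one_mul]
      exact cartanCoeff_mem_envPiece _ j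
    · exact Submodule.zero_mem _

theorem cartan_isMinimal : IsMinimal (envAug (ExtAlg.aug k n)) (cartanD k n) := by
  refine isMinimal_of_single fun i l b => ?_
  rw [← cartanMono_of_eq, cartanD_mono, Finsupp.finsetSum_apply, map_sum]
  refine Finset.sum_eq_zero fun j _ => ?_
  split_ifs with h
  · have h1 : cartanMono k i (l.1 - Finsupp.single j 1) (cartanCoeff k ((-1) ^ (i + 1)) j)
        = Finsupp.single (l.lower j h) _ := cartanMono_of_eq (l.lower j h) _
    rw [one_mul, h1]
    by_cases hb : l.lower j h = b
    · subst hb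
      rw [Finsupp.single_eq_same]
      exact envAug_eq_zero_of_mem_envPiece ExtAlg.aug_x _ (by simp) _ (cartanCoeff_mem_envPiece _ j)
    · rw [Finsupp.single_eq_of_ne fun h' => hb h'.symm, map_zero]
  · simp

end CartanResolution

/-! ### The polynomial ring and its Koszul complex -/

section Koszul

variable {k : Type*} [Field k] {n : ℕ}

/-- A word in commuting variables is the monomial counting its letters, and every exponent vector
comes from some word. -/
theorem poly_isHomogeneousBasis :
    IsHomogeneousBasis (algPiece (k := k) (MvPolynomial.X : Fin n → MvPolynomial (Fin n) k))
      (MvPolynomial.basisMonomials (Fin n) k) id := by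
  have hw : ∀ l : List (Fin n), (l.map (MvPolynomial.X : Fin n → MvPolynomial (Fin n) k)).prod
      = MvPolynomial.monomial (l.map fun s => Finsupp.single s 1).sum 1 := by
    intro l
    induction l with
    | nil => simp
    | cons j l ih =>
      rw [List.map_cons, List.prod_cons, List.map_cons, List.sum_cons, ih, MvPolynomial.X,
        MvPolynomial.monomial_mul, one_mul]
  have hl : ∀ α : Fin n →₀ ℕ, ∃ l : List (Fin n), (l.map fun s => Finsupp.single s 1).sum = α := by
    intro α
    refine ⟨α.toMultiset.toList, ?_⟩
    rw [← Multiset.sum_coe, ← Multiset.map_coe, Multiset.coe_toList]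
    induction α using Finsupp.induction_linear with
    | zero => simp
    | add a b ha hb => rw [map_add, Multiset.map_add, Multiset.sum_add, ha, hb]
    | single j m => simp [Multiset.map_nsmul, Multiset.sum_nsmul]
  intro α
  refine le_antisymm (Submodule.span_le.2 ?_) (Submodule.span_le.2 ?_)
  · rintro _ ⟨l, rfl, rfl⟩
    exact Submodule.subset_span ⟨_, rfl, by rw [MvPolynomial.coe_basisMonomials]; exact (hw l).symm⟩
  · rintro _ ⟨β, rfl, rfl⟩
    obtain ⟨l, hl⟩ := hl β
    exact Submodule.subset_span ⟨l, hl, by rw [MvPolynomial.coe_basisMonomials, hw, hl]⟩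

theorem polyAug_X (j : Fin n) : polyAug k n (MvPolynomial.X j) = 0 := by
  simp [polyAug]

/-! ### Koszul coefficients and division by them -/

variable (k) in
/-- The element `X_j ⊗ 1 - 1 ⊗ X_j`. -/
def koszulCoeff (j : Fin n) : Env k (MvPolynomial (Fin n) k) :=
  MvPolynomial.X j ⊗ₜ[k] 1 - 1 ⊗ₜ[k] MulOpposite.op (MvPolynomial.X j)

theorem koszulCoeff_mul_comm (i j : Fin n) :
    koszulCoeff k i * koszulCoeff k j = koszulCoeff k j * koszulCoeff k i := by
  simp only [koszulCoeff, mul_sub, sub_mul, Algebra.TensorProduct.tmul_mul_tmul, one_mul, mul_one,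
    ← MulOpposite.op_mul]
  rw [mul_comm (MvPolynomial.X i) (MvPolynomial.X j)]
  abel

variable (k) in
/-- The divided difference `(p - p|_{x_m = y_m}) / (x_m - y_m)` on `S ⊗ S = k[x, y]`. -/
def dividedDifference (m : Fin n) :
    Env k (MvPolynomial (Fin n) k) →ₗ[k] Env k (MvPolynomial (Fin n) k) :=
  TensorProduct.lift ((MvPolynomial.basisMonomials (Fin n) k).constr k fun a =>
    ∑ t ∈ Finset.range (a m), TensorProduct.mk k (MvPolynomial (Fin n) k) (MvPolynomial (Fin n) k)ᵐᵒᵖ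
        (MvPolynomial.monomial (a - Finsupp.single m (t + 1)) 1) ∘ₗ
      LinearMap.mulRight k (MulOpposite.op (MvPolynomial.X m) ^ t))

theorem dividedDifference_monomial (m : Fin n) (a : Fin n →₀ ℕ) (q : (MvPolynomial (Fin n) k)ᵐᵒᵖ) :
    dividedDifference k m (MvPolynomial.monomial a 1 ⊗ₜ[k] q) = ∑ t ∈ Finset.range (a m),
      MvPolynomial.monomial (a - Finsupp.single m (t + 1)) 1
        ⊗ₜ[k] (q * MulOpposite.op (MvPolynomial.X m) ^ t) := by
  have h : MvPolynomial.monomial a (1 : k) = MvPolynomial.basisMonomials (Fin n) k a := by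
    rw [MvPolynomial.coe_basisMonomials]
  rw [h, dividedDifference, TensorProduct.lift.tmul, Module.Basis.constr_basis, LinearMap.sum_apply]
  rfl

theorem monomial_tmul_mul_koszulCoeff (j : Fin n) (a : Fin n →₀ ℕ)
    (q : (MvPolynomial (Fin n) k)ᵐᵒᵖ) :
    (MvPolynomial.monomial a 1 ⊗ₜ[k] q) * koszulCoeff k j
      = MvPolynomial.monomial (a + Finsupp.single j 1) 1 ⊗ₜ[k] q
        - MvPolynomial.monomial a 1 ⊗ₜ[k] (q * MulOpposite.op (MvPolynomial.X j)) := by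
  rw [koszulCoeff, mul_sub, Algebra.TensorProduct.tmul_mul_tmul,
    Algebra.TensorProduct.tmul_mul_tmul, mul_one, mul_one, MvPolynomial.X, MvPolynomial.monomial_mul,
    one_mul]

theorem env_poly_ext {V : Type*} [AddCommGroup V] [Module k V]
    {f g : Env k (MvPolynomial (Fin n) k) →ₗ[k] V}
    (h : ∀ a q, f (MvPolynomial.monomial a 1 ⊗ₜ[k] q) = g (MvPolynomial.monomial a 1 ⊗ₜ[k] q)) :
    f = g := by
  refine TensorProduct.ext ((MvPolynomial.basisMonomials (Fin n) k).ext fun a => ?_)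
  ext q
  rw [MvPolynomial.coe_basisMonomials]
  exact h a _

/-- Division by `x_m - y_m` involves only the two copies of the `m`-th variable, so it commutes with
multiplication by `x_j - y_j`. -/
theorem dividedDifference_mul_of_ne {m j : Fin n} (hj : j ≠ m)
    (r : Env k (MvPolynomial (Fin n) k)) :
    dividedDifference k m (r * koszulCoeff k j) = dividedDifference k m r * koszulCoeff k j := by
  suffices h : dividedDifference k m ∘ₗ LinearMap.mulRight k (koszulCoeff k j)
      = LinearMap.mulRight k (koszulCoeff k j) ∘ₗ dividedDifference k m from LinearMap.congr_fun h r
  refine env_poly_ext fun a q => ?_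
  have h1 : (a + Finsupp.single j 1 : Fin n →₀ ℕ) m = a m := by simp [hj]
  rw [LinearMap.comp_apply, LinearMap.mulRight_apply, monomial_tmul_mul_koszulCoeff, map_sub,
    LinearMap.comp_apply, LinearMap.mulRight_apply, dividedDifference_monomial,
    dividedDifference_monomial, dividedDifference_monomial, Finset.sum_mul, h1,
    ← Finset.sum_sub_distrib]
  refine Finset.sum_congr rfl fun t ht => ?_
  -- The range `t < a m` ensures that the truncated subtraction is a true one.
  have h2 : Finsupp.single m (t + 1) ≤ a := by
    rw [Finsupp.single_le_iff]
    exact Finset.mem_range.1 ht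
  rw [monomial_tmul_mul_koszulCoeff, tsub_add_eq_add_tsub h2, mul_assoc, mul_assoc,
    mul_comm (MulOpposite.op (MvPolynomial.X j : MvPolynomial (Fin n) k))]

/-- On `x^a (x_m - y_m)` the two geometric sums differ by one term: the term `t = 0` of the longer
one is `x^a`, and the later terms cancel against the shorter one. -/
theorem dividedDifference_mul_self (m : Fin n) (r : Env k (MvPolynomial (Fin n) k)) :
    dividedDifference k m (r * koszulCoeff k m) = r := by
  suffices h : dividedDifference k m ∘ₗ LinearMap.mulRight k (koszulCoeff k m)
      = LinearMap.id from LinearMap.congr_fun h r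
  refine env_poly_ext fun a q => ?_
  have h1 : (a + Finsupp.single m 1 : Fin n →₀ ℕ) m = a m + 1 := by simp
  rw [LinearMap.comp_apply, LinearMap.mulRight_apply, monomial_tmul_mul_koszulCoeff, map_sub,
    dividedDifference_monomial, dividedDifference_monomial, h1, Finset.sum_range_succ', zero_add,
    pow_zero, mul_one, add_tsub_cancel_right, LinearMap.id_apply, add_sub_right_comm,
    ← Finset.sum_sub_distrib, Finset.sum_eq_zero, zero_add]
  intro t _
  rw [Finsupp.single_add m (t + 1) 1, add_tsub_add_eq_tsub_right, mul_assoc, ← pow_succ', sub_self]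

/-- The basis of the Koszul complex in homological degree `i`: the sets with `i` elements. -/
abbrev KoszulBasis (n i : ℕ) : Type := {I : Finset (Fin n) // I.card = i}

variable (k) in
/-- The multiples of the symbol `e_I` in homological degree `i`; zero if `I` does not have `i`
elements. -/
def koszulMono (i : ℕ) (I : Finset (Fin n)) : Env k (MvPolynomial (Fin n) k)
    →ₗ[Env k (MvPolynomial (Fin n) k)] (KoszulBasis n i →₀ Env k (MvPolynomial (Fin n) k)) :=
  if h : I.card = i then Finsupp.lsingle ⟨I, h⟩ else 0

theorem koszulMono_of_eq {i : ℕ} (I : KoszulBasis n i) (r : Env k (MvPolynomial (Fin n) k)) :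
    koszulMono k i I.1 r = Finsupp.single I r := by
  rw [koszulMono, dif_pos I.2]
  rfl

theorem koszulMono_of_ne {i : ℕ} {I : Finset (Fin n)} (h : I.card ≠ i)
    (r : Env k (MvPolynomial (Fin n) k)) : koszulMono k i I r = 0 := by
  rw [koszulMono, dif_neg h]
  rfl

variable (k) in
/-- The sign of moving `e_j` to the front of `e_I`. -/
def koszulSign (j : Fin n) (I : Finset (Fin n)) : k := (-1) ^ (I.filter (· < j)).card

theorem koszulSign_mul_self (j : Fin n) (I : Finset (Fin n)) :
    koszulSign k j I * koszulSign k j I = 1 := by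
  rw [koszulSign, ← mul_pow]
  simp

theorem koszulSign_insert {j m : Fin n} {I : Finset (Fin n)} (hm : m ∉ I) :
    koszulSign k j (insert m I) = if m < j then -koszulSign k j I else koszulSign k j I := by
  rw [koszulSign, koszulSign, Finset.filter_insert]
  split_ifs with h
  · rw [Finset.card_insert_of_notMem (by simp [hm]), pow_succ, mul_neg_one]
  · rfl

theorem koszulSign_erase {j m : Fin n} {I : Finset (Fin n)} (hm : m ∈ I) :
    koszulSign k j (I.erase m) = if m < j then -koszulSign k j I else koszulSign k j I := by
  have h := koszulSign_insert (k := k) (j := j) (Finset.notMem_erase m I)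
  rw [Finset.insert_erase hm] at h
  rw [h]
  split_ifs <;> simp

variable (k) in
/-- The Koszul differential `e_I ↦ ∑_{j ∈ I} ± (X_j ⊗ 1 - 1 ⊗ X_j) e_{I - j}`. -/
def koszulD (i : ℕ) : (KoszulBasis n (i + 1) →₀ Env k (MvPolynomial (Fin n) k))
    →ₗ[Env k (MvPolynomial (Fin n) k)] (KoszulBasis n i →₀ Env k (MvPolynomial (Fin n) k)) :=
  Finsupp.linearCombination (Env k (MvPolynomial (Fin n) k)) fun I => ∑ j : Fin n,
    if j ∈ I.1 then koszulMono k i (I.1.erase j) (koszulSign k j I.1 • koszulCoeff k j) else 0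

theorem smul_ite_map {R C : Type*} [Ring R] {p : Prop} [Decidable p]
    (f : R →ₗ[R] (C →₀ R)) (r s : R) : r • (if p then f s else 0) = if p then f (r * s) else 0 := by
  split_ifs
  · rw [← smul_eq_mul, map_smul]
  · rw [smul_zero]

theorem koszulD_mono (i : ℕ) (I : Finset (Fin n)) (r : Env k (MvPolynomial (Fin n) k)) :
    koszulD k i (koszulMono k (i + 1) I r) = ∑ j, if j ∈ I then
      koszulMono k i (I.erase j) (koszulSign k j I • (r * koszulCoeff k j)) else 0 := by
  by_cases hI : I.card = i + 1
  · rw [koszulMono_of_eq ⟨I, hI⟩]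
    refine (linearCombination_sum_single _ _ _).trans (Finset.sum_congr rfl fun j _ =>
      (smul_ite_map _ _ _).trans ?_)
    rw [mul_smul_comm]
  · rw [koszulMono_of_ne hI, map_zero]
    refine (Finset.sum_eq_zero fun j _ => ?_).symm
    split_ifs with h
    · refine koszulMono_of_ne (fun h' => hI ?_) _
      rw [← Finset.card_erase_add_one h, h']
    · rfl

/-- The coefficients commute, so the signs must do the cancelling: of `j` and `j'`, exactly one lies
below the other, hence the two orders of removal differ by a sign. -/
theorem koszulD_koszulD (i : ℕ) (z : KoszulBasis n (i + 2) →₀ Env k (MvPolynomial (Fin n) k)) :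
    koszulD k i (koszulD k (i + 1) z) = 0 := by
  induction z using Finsupp.induction_linear with
  | zero => simp
  | add y z hy hz => rw [map_add, map_add, hy, hz, add_zero]
  | single I r =>
    have h1 : ∀ j, koszulD k i (if j ∈ I.1 then koszulMono k (i + 1) (I.1.erase j)
        (koszulSign k j I.1 • (r * koszulCoeff k j)) else 0) = ∑ j', if j ∈ I.1 ∧ j' ∈ I.1.erase j
          then koszulMono k i ((I.1.erase j).erase j')
            ((koszulSign k j' (I.1.erase j) * koszulSign k j I.1) •
              (r * (koszulCoeff k j * koszulCoeff k j')))
          else 0 := by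
      intro j
      by_cases h : j ∈ I.1
      · rw [if_pos h, koszulD_mono]
        refine Finset.sum_congr rfl fun j' _ => ?_
        simp only [h, true_and, mul_assoc, smul_mul_assoc, smul_smul]
      · simp [h]
    rw [← koszulMono_of_eq, koszulD_mono, map_sum, Finset.sum_congr rfl fun j _ => h1 j]
    refine sum_sum_eq_zero_of_alternating
      (M := KoszulBasis n i →₀ Env k (MvPolynomial (Fin n) k)) (fun j => ?_) fun j j' hj => ?_
    · simp
    · by_cases h : j ∈ I.1 ∧ j' ∈ I.1
      · rw [if_pos ⟨h.1, Finset.mem_erase.2 ⟨hj.symm, h.2⟩⟩,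
          if_pos ⟨h.2, Finset.mem_erase.2 ⟨hj, h.1⟩⟩, Finset.erase_right_comm, ← map_add,
          koszulCoeff_mul_comm j' j, ← add_smul, koszulSign_erase h.1, koszulSign_erase h.2]
        have hs : (if j < j' then -koszulSign k j' I.1 else koszulSign k j' I.1) * koszulSign k j I.1
            + (if j' < j then -koszulSign k j I.1 else koszulSign k j I.1) * koszulSign k j' I.1
            = 0 := by
          rcases lt_or_gt_of_ne hj with h | h
          · rw [if_pos h, if_neg h.not_gt]; ring
          · rw [if_neg h.not_gt, if_pos h]; ring
        rw [hs, zero_smul, map_zero]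
      · rw [if_neg fun h' => h ⟨h'.1, Finset.mem_of_mem_erase h'.2⟩,
          if_neg fun h' => h ⟨Finset.mem_of_mem_erase h'.2, h'.1⟩, add_zero]

variable (k) in
/-- The homotopy `p e_I ↦ (Δ_m p) e_m e_I`. -/
def koszulHomotopy (m : Fin n) (i : ℕ) : (KoszulBasis n i →₀ Env k (MvPolynomial (Fin n) k)) →ₗ[k]
    (KoszulBasis n (i + 1) →₀ Env k (MvPolynomial (Fin n) k)) :=
  Finsupp.lsum k fun I => if m ∈ I.1 then 0 else koszulSign k m I.1 •
    (koszulMono k (i + 1) (insert m I.1)).restrictScalars k ∘ₗ dividedDifference k m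

theorem koszulHomotopy_mono (m : Fin n) (i : ℕ) (I : Finset (Fin n))
    (r : Env k (MvPolynomial (Fin n) k)) :
    koszulHomotopy k m i (koszulMono k i I r) = if m ∈ I then 0 else
      koszulMono k (i + 1) (insert m I) (koszulSign k m I • dividedDifference k m r) := by
  by_cases hI : I.card = i
  · rw [koszulMono_of_eq ⟨I, hI⟩, koszulHomotopy, Finsupp.lsum_single]
    split_ifs with h
    · rfl
    · exact (((koszulMono k (i + 1) (insert m I)).restrictScalars k).map_smul _ _).symm
  · rw [koszulMono_of_ne hI, map_zero]
    split_ifs with h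
    · rfl
    · rw [koszulMono_of_ne]
      rw [Finset.card_insert_of_notMem h]
      omega

/-- If `m ∈ I`, the homotopy kills `r e_I` and every term of `h d` but the one for `j = m`, where
division returns `r`. If `m ∉ I`, the terms with `j ≠ m` cancel by sign and a multiple of `e_I`
remains. -/
theorem koszulD_homotopy (m : Fin n) (i : ℕ) (I : KoszulBasis n (i + 1))
    (r : Env k (MvPolynomial (Fin n) k)) :
    ∃ s, koszulD k (i + 1) (koszulHomotopy k m (i + 1) (Finsupp.single I r))
      + koszulHomotopy k m i (koszulD k i (Finsupp.single I r)) = Finsupp.single I s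
        ∧ (m ∈ I.1 → s = r) := by
  rw [← koszulMono_of_eq I r, koszulHomotopy_mono, koszulD_mono, map_sum]
  by_cases hm : m ∈ I.1
  · refine ⟨r, ?_, fun _ => rfl⟩
    rw [if_pos hm, map_zero, zero_add, Finset.sum_eq_single m]
    · rw [if_pos hm, koszulHomotopy_mono, if_neg (Finset.notMem_erase m _),
        Finset.insert_erase hm, (dividedDifference k m).map_smul, dividedDifference_mul_self, koszulSign_erase hm,
        if_neg (lt_irrefl m), smul_smul, koszulSign_mul_self, one_smul, koszulMono_of_eq]
    · intro j _ hj
      split_ifs with h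
      · rw [koszulHomotopy_mono, if_pos (Finset.mem_erase.2 ⟨hj.symm, hm⟩)]
      · rw [map_zero]
    · exact fun h => absurd (Finset.mem_univ m) h
  · refine ⟨koszulSign k m (insert m I.1) • (koszulSign k m I.1 • dividedDifference k m r *
      koszulCoeff k m), ?_, fun h => absurd h hm⟩
    rw [if_neg hm, koszulD_mono, ← Finset.sum_add_distrib, Finset.sum_eq_single m]
    · rw [if_pos (Finset.mem_insert_self _ _), if_neg hm, map_zero, add_zero,
        Finset.erase_insert hm, koszulMono_of_eq]
    · intro j _ hj
      by_cases h : j ∈ I.1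
      · rw [if_pos (Finset.mem_insert_of_mem h), if_pos h, koszulHomotopy_mono,
          if_neg fun h' => hm (Finset.mem_of_mem_erase h'), Finset.erase_insert_of_ne hj.symm,
          ← map_add, (dividedDifference k m).map_smul, dividedDifference_mul_of_ne hj, smul_mul_assoc, smul_smul, smul_smul,
          ← add_smul, koszulSign_insert hm, koszulSign_erase h]
        have hs : (if m < j then -koszulSign k j I.1 else koszulSign k j I.1) * koszulSign k m I.1
            + (if j < m then -koszulSign k m I.1 else koszulSign k m I.1) * koszulSign k j I.1
            = 0 := by
          rcases lt_or_gt_of_ne hj with h | h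
          · rw [if_neg h.not_gt, if_pos h]; ring
          · rw [if_pos h, if_neg h.not_gt]; ring
        rw [hs, zero_smul, map_zero]
      · rw [if_neg h, if_neg (by simp [h, hj]), map_zero, add_zero]
    · exact fun h => absurd (Finset.mem_univ m) h

theorem koszulD_exact (i : ℕ) :
    Function.Exact (koszulD (n := n) k (i + 1)) (koszulD (n := n) k i) := by
  refine exact_of_partial_homotopies koszulD_koszulD (fun _ I m => m ∈ I.1) (koszulHomotopy k)
    koszulD_homotopy (fun i I => ?_) i
  refine Finset.card_pos.1 ?_
  rw [I.2]
  omega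

instance : Unique (KoszulBasis n 0) where
  default := ⟨∅, rfl⟩
  uniq I := Subtype.ext (Finset.card_eq_zero.1 I.2)

theorem koszulCoeff_mem_envPiece (j : Fin n) : koszulCoeff k j ∈
    envPiece (k := k) (MvPolynomial.X : Fin n → MvPolynomial (Fin n) k) (Finsupp.single j 1) := by
  have h1 := tmul_mem_envPiece (generator_mem_algPiece (k := k)
    (x := (MvPolynomial.X : Fin n → MvPolynomial (Fin n) k)) j) one_mem_algPiece
  have h2 := tmul_mem_envPiece (one_mem_algPiece (k := k)
    (x := (MvPolynomial.X : Fin n → MvPolynomial (Fin n) k))) (generator_mem_algPiece j)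
  rw [add_zero] at h1
  rw [zero_add] at h2
  exact Submodule.sub_mem _ h1 h2

variable (k n) in
/-- The augmentation of the Koszul complex. -/
def koszulAug : (KoszulBasis n 0 →₀ Env k (MvPolynomial (Fin n) k))
    →ₗ[Env k (MvPolynomial (Fin n) k)] MvPolynomial (Fin n) k :=
  Finsupp.linearCombination _ fun _ => (1 : MvPolynomial (Fin n) k)

theorem koszulAug_exact : Function.Exact (koszulD k 0) (koszulAug k n) := by
  refine exact_augmentation (x := (MvPolynomial.X : Fin n → MvPolynomial (Fin n) k))
    poly_isHomogeneousBasis.iSup_eq_top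
    (fun I => ?_) fun j => ⟨Finsupp.single ⟨{j}, Finset.card_singleton j⟩ 1, ?_⟩
  · rw [← koszulMono_of_eq, koszulD_mono, map_sum]
    refine Finset.sum_eq_zero fun j _ => ?_
    split_ifs with h
    · have hd : (I.1.erase j).card = 0 := by
        have := Finset.card_erase_add_one h
        have := I.2
        omega
      have hc : koszulCoeff k j • (1 : MvPolynomial (Fin n) k) = 0 := by
        rw [koszulCoeff, sub_smul (MvPolynomial.X j ⊗ₜ[k] 1 : Env k (MvPolynomial (Fin n) k))
          (1 ⊗ₜ[k] MulOpposite.op (MvPolynomial.X j)) (1 : MvPolynomial (Fin n) k), env_tmul_smul,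
          env_tmul_smul]
        simp
      rw [koszulMono_of_eq ⟨_, hd⟩, Finsupp.linearCombination_single, one_mul, smul_assoc, hc,
        smul_zero]
    · rw [map_zero]
  · rw [← koszulMono_of_eq, koszulD_mono, Finset.sum_eq_single j]
    · have hs : koszulSign k j {j} = 1 := by simp [koszulSign, Finset.filter_singleton]
      rw [if_pos (by simp), hs, one_smul, one_mul]
      have he : (({j} : Finset (Fin n)).erase j) = (default : KoszulBasis n 0).1 := by
        rw [Finset.erase_singleton]
        rfl
      exact (congrArg (koszulMono k 0 · (koszulCoeff k j)) he).trans (koszulMono_of_eq _ _)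
    · intro j' _ hj
      rw [if_neg (by simp [hj])]
    · exact fun h => absurd (Finset.mem_univ j) h

theorem koszul_isMultigradedFreeResolution :
    IsMultigradedFreeResolution (envPiece (MvPolynomial.X : Fin n → MvPolynomial (Fin n) k))
      (algPiece (MvPolynomial.X : Fin n → MvPolynomial (Fin n) k)) (B := KoszulBasis n)
      (fun _ I => finsetDeg I.1) (koszulD k) (koszulAug k n) where
  aug_surjective a := ⟨Finsupp.single default (a ⊗ₜ[k] 1), by
    rw [koszulAug, Finsupp.linearCombination_single, env_tmul_smul]
    simp⟩
  exact_zero := koszulAug_exact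
  exact_succ := koszulD_exact
  aug_homogeneous I := by
    rw [koszulAug, Finsupp.linearCombination_single, one_smul, Finset.card_eq_zero.1 I.2]
    exact one_mem_algPiece
  d_homogeneous i I := by
    rw [← koszulMono_of_eq, koszulD_mono]
    refine Submodule.sum_mem _ fun j _ => ?_
    split_ifs with h
    · have hd : (I.1.erase j).card = i := by
        have := Finset.card_erase_add_one h
        have := I.2
        omega
      refine Submodule.subset_span ⟨⟨I.1.erase j, hd⟩, Finsupp.single j 1, ?_, _, ?_,
        koszulMono_of_eq ⟨I.1.erase j, hd⟩ _⟩
      · rw [← finsetDeg_insert (Finset.notMem_erase j _), Finset.insert_erase h]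
      · rw [one_mul]
        exact Submodule.smul_mem _ _ (koszulCoeff_mem_envPiece j)
    · exact Submodule.zero_mem _

theorem koszul_isMinimal : IsMinimal (envAug (polyAug k n)) (koszulD (n := n) k) := by
  refine isMinimal_of_single fun i I b => ?_
  rw [← koszulMono_of_eq, koszulD_mono, Finsupp.finsetSum_apply, map_sum]
  refine Finset.sum_eq_zero fun j _ => ?_
  split_ifs with h
  · have hd : (I.1.erase j).card = i := by
      have := Finset.card_erase_add_one h
      have := I.2
      omega
    rw [one_mul, koszulMono_of_eq ⟨_, hd⟩]
    by_cases hb : (⟨_, hd⟩ : KoszulBasis n i) = b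
    · subst hb
      rw [Finsupp.single_eq_same, map_smul, envAug_eq_zero_of_mem_envPiece polyAug_X _ (by simp) _
        (koszulCoeff_mem_envPiece j), smul_zero]
    · rw [Finsupp.single_eq_of_ne fun h' => hb h'.symm, map_zero]
  · simp

end Koszul

/-! ### Hilbert series -/

section Hilbert

theorem dimK_of_isHomogeneousBasis {k : Type*} [Field k] {σ V J : Type*} [AddCommGroup V]
    [Module k V] {gr : (σ →₀ ℕ) → Submodule k V} {v : Module.Basis J k V} {deg : J → σ →₀ ℕ}
    (h : IsHomogeneousBasis gr v deg) (α : σ →₀ ℕ) :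
    dimK (k := k) (gr α) = ENat.card {j // deg j = α} := by
  have hl : LinearIndependent k fun j : {j // deg j = α} => v j.1 :=
    v.linearIndependent.comp _ Subtype.val_injective
  have hs : Submodule.span k (Set.range fun j : {j // deg j = α} => v j.1) = gr α := by
    rw [h]
    congr 1
    ext z
    simp
  rw [← hs, dimK_eq_of_equiv (Module.Basis.span hl).repr, dimK, rank_finsupp_self,
    Cardinal.toENat_lift]
  rfl

/-- The size of an index is its total degree, so fixing both is either redundant or contradictory.
Applied to symbols, this forces the exponent of `t` to be `|α|`. -/
theorem card_subtype_degree {J σ : Type*} {deg : J → σ →₀ ℕ} {size : J → ℕ}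
    (h : ∀ j, (deg j).degree = size j) (i : ℕ) (α : σ →₀ ℕ) :
    ENat.card {b : {j // size j = i} // deg b.1 = α}
      = if i = α.degree then ENat.card {j // deg j = α} else 0 := by
  split_ifs with hi
  · exact ENat.card_congr (Equiv.subtypeSubtypeEquivSubtype (p := fun j => size j = i)
      (q := fun j => deg j = α) fun {j} hj => by rw [← h, hj, hi])
  · rw [ENat.card_eq_zero_iff_empty]
    refine ⟨fun b => hi ?_⟩
    rw [← b.2, h, b.1.2]

variable {k : Type*} [Field k] {n : ℕ}

/-- The symbols `e^{(l)}` and the monomials `X^l` share their indices and degrees. -/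
theorem hilbHH_extAlg : hilbHH (ExtAlg.aug k n) (ExtAlg.x k n)
    = hilbAlg k (MvPolynomial.X : Fin n → MvPolynomial (Fin n) k) := by
  funext m
  rw [hilbHH_eq_hilbTor ExtAlg.isHomogeneousBasis_basis _ cartan_isMultigradedFreeResolution,
    hilbTor_envPiece_of_isMinimal ExtAlg.aug_x cartan_isMinimal, hilbAlg,
    dimK_of_isHomogeneousBasis poly_isHomogeneousBasis]
  exact card_subtype_degree (deg := id) (fun _ => rfl) _ _

/-- The Koszul symbols and the basis monomials of `E` are both indexed by subsets, with the same
degrees. -/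
theorem hilbHH_poly :
    hilbHH (polyAug k n) (MvPolynomial.X : Fin n → MvPolynomial (Fin n) k)
      = hilbAlg k (ExtAlg.x k n) := by
  funext m
  rw [hilbHH_eq_hilbTor poly_isHomogeneousBasis _ koszul_isMultigradedFreeResolution,
    hilbTor_envPiece_of_isMinimal polyAug_X koszul_isMinimal, hilbAlg,
    dimK_of_isHomogeneousBasis ExtAlg.isHomogeneousBasis_basis]
  exact card_subtype_degree finsetDeg_degree _ _

end Hilbert

end HochschildDuality

end

/-- Let `E` be the exterior algebra on `n` generators over a field `k` and `S` the polynomial ring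
in `n` variables. The divided power complex is a (multigraded) minimal free resolution of `E` over
`E ⊗ Eᵒᵖ`; the Hilbert series of `HH(E, k)` is the one of `Tor^{E ⊗ Eᵒᵖ}(k, E)` (computed by an
arbitrary multigraded free resolution of `E`); and `Hilb HH(E, k) = Hilb S`,
`Hilb HH(S, k) = Hilb E`. -/
theorem theorem5p3 {k : Type*} [Field k] (n : ℕ) :
    (IsMultigradedFreeResolution (N := ExtAlg k n) (envPiece (ExtAlg.x k n))
        (algPiece (ExtAlg.x k n)) (B := CartanBasis n) (fun _ l => l.1) (cartanD k n)
        (cartanAug k n) ∧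
      IsMinimal (envAug (ExtAlg.aug k n)) (cartanD k n)) ∧
    (∀ (B : ℕ → Type*) (deg : ∀ i, B i → Fin n →₀ ℕ)
        (d : ∀ i, (B (i + 1) →₀ Env k (ExtAlg k n)) →ₗ[Env k (ExtAlg k n)]
          (B i →₀ Env k (ExtAlg k n)))
        (aug : (B 0 →₀ Env k (ExtAlg k n)) →ₗ[Env k (ExtAlg k n)] ExtAlg k n),
      IsMultigradedFreeResolution (envPiece (ExtAlg.x k n)) (algPiece (ExtAlg.x k n)) deg d aug →
        hilbHH (ExtAlg.aug k n) (ExtAlg.x k n)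
          = hilbTor (envAug (ExtAlg.aug k n)) (envPiece (ExtAlg.x k n)) deg d) ∧
    hilbHH (ExtAlg.aug k n) (ExtAlg.x k n) =
      hilbAlg k (MvPolynomial.X : Fin n → MvPolynomial (Fin n) k) ∧
    hilbHH (polyAug k n) (MvPolynomial.X : Fin n → MvPolynomial (Fin n) k)
      = hilbAlg k (ExtAlg.x k n) := by
  exact ⟨⟨cartan_isMultigradedFreeResolution, cartan_isMinimal⟩, fun B deg d aug h =>
    hilbHH_eq_hilbTor ExtAlg.isHomogeneousBasis_basis _ h, hilbHH_extAlg, hilbHH_poly⟩
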